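/- For an ordinal $\alpha$, the $\alpha$-bicyclic monoid $\mathcal B_\alpha$ is the set $\omega^\alpha\times\omega^\alpha$ of pairs of ordinals below $\omega^\alpha$ with the operation $$(a,b)\cdot(c,d)=\begin{cases}(a+(c-b),d), & b\le c,\\ (a,d+(b-c)), & b>c,\end{cases}$$ where for $b\le c$ the ordinal $c-b$ is the unique $x$ with $b+x=c$. A topology on a monoid $S$ is *shift-continuous* if for all $a,b\in S$ the map $x\mapsto axb$ is continuous. For ordinals $1\le i\le\alpha\le\omega$ let $\tau_{i,\alpha}$ denote the locally compact Hausdorff shift-continuous topology on $\mathcal B_\alpha$ such that (i) for every integer $j$ with $i\le j<\alpha$ the point $(\omega^j,\omega^j)$ is isolated; (ii) for every integer $j$ with $1\le j<i$ and $j<\alpha$ the sets $$U_n=\{(a,b): a,b<\omega^j \text{ and } (n\omega^{j-1}<a \text{ or } n\omega^{j-1}<b)\}\cup\{(\omega^j,\omega^j)\},\qquad n=1,2,\dots,$$ form a base of (not necessarily open) neighborhoods at $(\omega^j,\omega^j)$, where $n\omega^{j-1}$ is the sum of $n$ copies of $\omega^{j-1}$. **Corollary.** Let $1\le\alpha\le\omega$.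 For every ordinal $i$ with $1\le i\le\alpha$ the topology $\tau_{i,\alpha}$ exists and is unique. The locally compact Hausdorff shift-continuous topologies on $\mathcal B_\alpha$ are exactly the topologies $\tau_{i,\alpha}$, $1\le i\le\alpha$. They are linearly ordered by inclusion, with $\tau_{j,\alpha}\subsetneq\tau_{i,\alpha}$ for $1\le i<j\le\alpha$. Hence the lattice of these topologies, ordered by inclusion, is anti-isomorphic, via $\tau_{i,\alpha}\mapsto i$, to the segment of ordinals $[1,\alpha]$ with its natural well-order. -/

import Mathlib

universe u

open scoped Ordinal Topology

/-- The underlying set `ω^α × ω^α` of the `α`-bicyclic monoid: pairs of ordinals below `ω^α`. -/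
@[ext]
structure AlphaBicyclic (α : Ordinal.{u}) : Type (u + 1) where
  fst : Ordinal.{u}
  snd : Ordinal.{u}
  fst_lt : fst < ω ^ α
  snd_lt : snd < ω ^ α

namespace AlphaBicyclic

variable {α : Ordinal.{u}}

theorem add_sub_lt {a b c : Ordinal.{u}} (ha : a < ω ^ α) (hc : c < ω ^ α) :
    a + (c - b) < ω ^ α :=
  Ordinal.isPrincipal_add_omega0_opow α ha (lt_of_le_of_lt (Ordinal.sub_le_self c b) hc)

/-- `(a, b) * (c, d)` is `(a + (c - b), d)` if `b ≤ c`, and `(a, d + (b - c))` if `b > c`. -/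
noncomputable instance : Mul (AlphaBicyclic α) where
  mul x y :=
    if x.snd ≤ y.fst then
      ⟨x.fst + (y.fst - x.snd), y.snd, add_sub_lt x.fst_lt y.fst_lt, y.snd_lt⟩
    else
      ⟨x.fst, y.snd + (x.snd - y.fst), x.fst_lt, add_sub_lt y.snd_lt x.snd_lt⟩

noncomputable instance : One (AlphaBicyclic α) where
  one := ⟨0, 0, Ordinal.opow_pos α Ordinal.omega0_pos, Ordinal.opow_pos α Ordinal.omega0_pos⟩

theorem mul_def (x y : AlphaBicyclic α) : x * y =
    if x.snd ≤ y.fst then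
      ⟨x.fst + (y.fst - x.snd), y.snd, add_sub_lt x.fst_lt y.fst_lt, y.snd_lt⟩
    else
      ⟨x.fst, y.snd + (x.snd - y.fst), x.fst_lt, add_sub_lt y.snd_lt x.snd_lt⟩ := rfl

theorem mul_fst (x y : AlphaBicyclic α) : (x * y).fst = x.fst + (y.fst - x.snd) := by
  rw [mul_def]
  split_ifs with h
  · rfl
  · simp [Ordinal.sub_eq_zero_iff_le.2 (not_le.1 h).le]

theorem mul_snd (x y : AlphaBicyclic α) : (x * y).snd = y.snd + (x.snd - y.fst) := by
  rw [mul_def]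
  split_ifs with h
  · simp [Ordinal.sub_eq_zero_iff_le.2 h]
  · rfl

theorem one_fst : (1 : AlphaBicyclic α).fst = 0 := rfl

theorem one_snd : (1 : AlphaBicyclic α).snd = 0 := rfl

theorem add_sub_add_left (a b c : Ordinal.{u}) : (a + b) - (a + c) = b - c := by
  rw [← Ordinal.sub_sub, Ordinal.add_sub_cancel]

theorem assoc_aux (b c d e : Ordinal.{u}) :
    (c - b) + (e - (d + (b - c))) = (c + (e - d)) - b := by
  rcases le_total b c with h | h
  · obtain ⟨u, rfl⟩ := exists_add_of_le h
    rw [Ordinal.add_sub_cancel, Ordinal.sub_eq_zero_iff_le.2 h, add_zero, add_assoc,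
      Ordinal.add_sub_cancel]
  · obtain ⟨u, rfl⟩ := exists_add_of_le h
    rw [Ordinal.add_sub_cancel, add_sub_add_left, Ordinal.sub_eq_zero_iff_le.2 h, zero_add,
      ← Ordinal.sub_sub]

noncomputable instance : Monoid (AlphaBicyclic α) where
  mul_assoc x y z := by
    ext
    · simp only [mul_fst, mul_snd]
      rw [add_assoc, assoc_aux]
    · simp only [mul_fst, mul_snd]
      rw [add_assoc, assoc_aux]
  one_mul x := by
    ext <;> simp [mul_fst, mul_snd, one_fst, one_snd]
  mul_one x := by
    ext <;> simp [mul_fst, mul_snd, one_fst, one_snd]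

/-- The point `(ω^j, ω^j)` of the `α`-bicyclic monoid, for an integer `0 ≤ j < α`. -/
noncomputable def diag (j : ℕ) (hj : (j : Ordinal.{u}) < α) : AlphaBicyclic α where
  fst := ω ^ (j : Ordinal.{u})
  snd := ω ^ (j : Ordinal.{u})
  fst_lt := (Ordinal.opow_lt_opow_iff_right Ordinal.one_lt_omega0).2 hj
  snd_lt := (Ordinal.opow_lt_opow_iff_right Ordinal.one_lt_omega0).2 hj

/-- For `1 ≤ j < α`, the set of all `(a, b)` with `a, b < ω^j` such that `n ω^(j-1) < a` or
`n ω^(j-1) < b`, together with the point `(ω^j, ω^j)`. The multiple `n ω^(j-1)` of the Cantor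
normal form is the ordinal product `ω^(j-1) * n`. -/
def basicNhd (j : ℕ) (hj : (j : Ordinal.{u}) < α) (n : ℕ) : Set (AlphaBicyclic α) :=
  {x | x.fst < ω ^ (j : Ordinal.{u}) ∧ x.snd < ω ^ (j : Ordinal.{u}) ∧
      (ω ^ ((j - 1 : ℕ) : Ordinal.{u}) * (n : Ordinal.{u}) < x.fst ∨
        ω ^ ((j - 1 : ℕ) : Ordinal.{u}) * (n : Ordinal.{u}) < x.snd)} ∪ {diag j hj}

end AlphaBicyclic

/-- A topology on a monoid is shift-continuous if all two-sided shifts `x ↦ a x b` are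
continuous. -/
def IsShiftContinuous {S : Type*} [Monoid S] (τ : TopologicalSpace S) : Prop :=
  ∀ a b : S, Continuous[τ, τ] (fun x => a * x * b)

/-- Locally compact Hausdorff shift-continuous topologies on a monoid. -/
structure IsLCShiftTopology {S : Type*} [Monoid S] (τ : TopologicalSpace S) : Prop where
  t2 : @T2Space S τ
  locallyCompact : @LocallyCompactSpace S τ
  shiftContinuous : IsShiftContinuous τ

/-- `τ` is the topology `τ_{i,α}` on the `α`-bicyclic monoid: the locally compact Hausdorff
shift-continuous topology for which `(ω^j, ω^j)` is isolated when `i ≤ j < α` and has the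
neighborhood base `basicNhd j n`, `n = 1, 2, …`, when `1 ≤ j < i`. -/
structure IsTau (α i : Ordinal.{u}) (τ : TopologicalSpace (AlphaBicyclic α)) : Prop
    extends IsLCShiftTopology τ where
  isolated : ∀ (j : ℕ) (hj : (j : Ordinal.{u}) < α), i ≤ (j : Ordinal.{u}) →
    IsOpen[τ] {AlphaBicyclic.diag j hj}
  hasBasis : ∀ (j : ℕ) (hj : (j : Ordinal.{u}) < α), 1 ≤ j → (j : Ordinal.{u}) < i →
    (@nhds _ τ (AlphaBicyclic.diag j hj)).HasBasis (fun n : ℕ => 1 ≤ n)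
      (AlphaBicyclic.basicNhd j hj)

/-- A topology as the set of its open sets, so that topologies are compared by inclusion. -/
def openSets {X : Type*} (τ : TopologicalSpace X) : Set (Set X) := {U | IsOpen[τ] U}

/-! Everything is reduced to the points `diag j` = (ω^j, ω^j). In a Hausdorff shift-continuous
topology the sets {a < c} and {b < c} are open, being complements of fixed-point sets of
multiplication by an idempotent. Hence 1 is isolated, and each `up q`, the preimage of {1} under a
shift, is clopen. A point x with `up x` ≠ {x} is a translate of some `diag s`, and translation
carries neighborhoods of `diag s` to neighborhoods of x (`nhds_embed_diag`). So the topology is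
determined by its neighborhood filters at the points `diag j`, j ≥ 1 (`le_of_nhds_diag_le`).

Each `basicNhd j n` is a neighborhood of `diag j` in every such topology (`basicNhd_mem_nhds`).
Under local compactness these sets are a base unless `diag j` is isolated. Indeed, a compact
neighborhood K inside `up (diag j)` is stable, outside some square, under the elementary shifts
fixing `diag j`. If K has a point outside this square, such shifts move it everywhere outside the
square (`IsTailInvariant.forall_of_exists`), so K contains a basic neighborhood. Moreover, if `diag
(j + 1)` is not isolated, neither is `diag j` for j ≥ 1 (`not_isOpen_singleton_diag_of_succ`). A
single threshold i therefore describes the topology.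

Conversely, declaring the translates of the `basicNhd j n`, j < i, to be neighborhoods gives a
shift-continuous topology. It is locally compact because `up (diag j)` is compact for j < i, by
induction on j. Raising i turns isolated points into non-isolated ones, so the topology becomes
strictly coarser. -/

namespace Ordinal

/-! ### Ordinal arithmetic with powers of ω -/

theorem omega0_opow_natCast_succ (k : ℕ) :
    ω ^ ((k + 1 : ℕ) : Ordinal.{u}) = ω ^ (k : Ordinal.{u}) * ω := by
  rw [Nat.cast_succ, opow_add_one]

theorem lt_omega0_opow_natCast_succ {k : ℕ} {x : Ordinal.{u}} :
    x < ω ^ ((k + 1 : ℕ) : Ordinal.{u}) ↔ ∃ n : ℕ, x < ω ^ (k : Ordinal.{u}) * n := by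
  rw [Nat.cast_succ]
  exact lt_omega0_opow_succ

theorem omega0_opow_mul_natCast_lt (k n : ℕ) :
    ω ^ (k : Ordinal.{u}) * n < ω ^ ((k + 1 : ℕ) : Ordinal.{u}) :=
  opow_mul_lt_opow (natCast_lt_omega0 n) (by exact_mod_cast Nat.lt_succ_self k)

theorem omega0_opow_mul_natCast_le (k : ℕ) {m n : ℕ} (h : m ≤ n) :
    ω ^ (k : Ordinal.{u}) * m ≤ ω ^ (k : Ordinal.{u}) * n :=
  mul_le_mul_right (by exact_mod_cast h) _

theorem omega0_opow_add_lt {e x y : Ordinal.{u}} (hx : x < ω ^ e) (hy : y < ω ^ e) :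
    x + y < ω ^ e :=
  isPrincipal_add_omega0_opow e hx hy

theorem omega0_opow_natCast_lt_iff {j k : ℕ} :
    ω ^ (j : Ordinal.{u}) < ω ^ (k : Ordinal.{u}) ↔ j < k := by
  rw [opow_lt_opow_iff_right one_lt_omega0, Nat.cast_lt]

theorem omega0_opow_sub {e x : Ordinal.{u}} (hx : x < ω ^ e) : ω ^ e - x = ω ^ e :=
  sub_eq_of_add_eq (add_omega0_opow hx)

/-- Only finitely many ordinals are final segments of a given ordinal. -/
theorem finite_range_sub_left (c : Ordinal.{u}) : (Set.range (c - ·)).Finite := by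
  have : WellFoundedGT (Set.range (c - ·)) := by
    choose g hg using fun s : Set.range (c - ·) => s.2
    -- Subtraction is antitone in the subtrahend: a larger final segment comes from a smaller `g`.
    -- The range is thus well-ordered in both directions, hence finite.
    refine ⟨Subrelation.wf (r := InvImage (· < ·) g) ?_ (InvImage.wf g wellFounded_lt)⟩
    intro s t hst
    by_contra! h
    have h' : g t ≤ g s := not_lt.1 h
    have : c - g s ≤ c - g t := sub_le.2 ((le_add_sub c (g t)).trans (by gcongr))
    have hs : c - g s = s := hg s
    have ht : c - g t = t := hg t
    rw [hs, ht] at this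
    exact absurd hst (not_lt.2 this)
  have := Finite.of_wellFoundedLT_wellFoundedGT (Set.range (c - ·))
  exact Set.toFinite _

/-- The powers of `ω` dividing an ordinal are those dividing a nonzero final segment of it. -/
theorem omega0_opow_dvd_add_iff {e x v : Ordinal.{u}} (hv : v ≠ 0) :
    ω ^ e ∣ x + v ↔ ω ^ e ∣ v := by
  have hW : ω ^ e ≠ 0 := opow_ne_zero _ omega0_ne_zero
  have hr : x % ω ^ e < ω ^ e := mod_lt x hW
  have key : ω ^ e ∣ x + v ↔ ω ^ e ∣ x % ω ^ e + v := by
    conv_lhs => rw [← div_add_mod x (ω ^ e), add_assoc]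
    exact dvd_add_iff (dvd_mul_right _ _)
  rw [key]
  constructor
  · rintro ⟨w, hw⟩
    have hw0 : w ≠ 0 := by
      rintro rfl
      simp [hv] at hw
    -- The remainder is absorbed by the nonzero multiple of ω^e, so it may be inserted on the right
    -- of `hw` and cancelled on the left.
    have : x % ω ^ e + ω ^ e * w = ω ^ e * w :=
      add_of_omega0_opow_le hr (le_of_dvd (mul_ne_zero hW hw0) (dvd_mul_right _ _))
    rw [← this] at hw
    exact ⟨w, add_left_cancel hw⟩
  · intro h
    rwa [add_of_omega0_opow_le hr (le_of_dvd hv h)]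

/-- Here s is the last exponent of the Cantor normal form, found as the predecessor of the least n
with ω^n not dividing a. The bound a < ω^ω makes it finite. -/
theorem exists_eq_omega0_opow_mul_succ {a : Ordinal.{u}} (ha : a ≠ 0)
    (ha' : a < ω ^ (ω : Ordinal.{u})) :
    ∃ (s : ℕ) (q : Ordinal.{u}), a = ω ^ (s : Ordinal.{u}) * (q + 1) := by
  classical
  have hex : ∃ n : ℕ, ¬ ω ^ (n : Ordinal.{u}) ∣ a := by
    obtain ⟨b, hb, hab⟩ := (lt_opow_of_isSuccLimit omega0_ne_zero isSuccLimit_omega0).1 ha'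
    obtain ⟨n, rfl⟩ := lt_omega0.1 hb
    exact ⟨n, fun h => absurd (le_of_dvd ha h) (not_le.2 hab)⟩
  obtain ⟨s, hs⟩ : ∃ s, Nat.find hex = s + 1 := by
    refine Nat.exists_eq_succ_of_ne_zero fun h => ?_
    have := Nat.find_spec hex
    rw [h] at this
    simp at this
  have h1 : ¬ ω ^ ((s + 1 : ℕ) : Ordinal.{u}) ∣ a := hs ▸ Nat.find_spec hex
  obtain ⟨q, hq⟩ : ω ^ (s : Ordinal.{u}) ∣ a := not_not.1 (Nat.find_min hex (by omega))
  have hq' : ¬ ω ∣ q := by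
    rintro ⟨r, rfl⟩
    exact h1 ⟨r, by rw [hq, omega0_opow_natCast_succ, mul_assoc]⟩
  rw [← isSuccPrelimit_iff_omega0_dvd, Order.not_isSuccPrelimit_iff_mem_range_succ] at hq'
  obtain ⟨r, rfl⟩ := hq'
  exact ⟨s, r, by rw [hq, Order.succ_eq_add_one]⟩

theorem omega0_opow_dvd_mul_add_one_iff {s t : ℕ} {q : Ordinal.{u}} :
    ω ^ (t : Ordinal.{u}) ∣ ω ^ (s : Ordinal.{u}) * (q + 1) ↔ t ≤ s := by
  rw [mul_add, mul_one, omega0_opow_dvd_add_iff (opow_ne_zero _ omega0_ne_zero),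
    opow_dvd_opow_iff one_lt_omega0, Nat.cast_le]

/-- A set of ordinals containing `0` and closed under `x ↦ ω ^ i + x` for `i < k` contains every
ordinal below `ω ^ k`. -/
theorem omega0_opow_induction {p : Ordinal.{u} → Prop} (k : ℕ) (h0 : p 0)
    (hp : ∀ i < k, ∀ x < ω ^ (k : Ordinal.{u}), p x → p (ω ^ (i : Ordinal.{u}) + x)) :
    ∀ x < ω ^ (k : Ordinal.{u}), p x := by
  induction k with
  | zero =>
    intro x hx
    rw [Nat.cast_zero, opow_zero, Order.lt_one_iff] at hx
    rwa [hx]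
  | succ k ih =>
    have ih' := ih fun i hi x hx => hp i (by omega) x
      (hx.trans (omega0_opow_natCast_lt_iff.2 (Nat.lt_succ_self k)))
    have key : ∀ (n : ℕ), ∀ r < ω ^ (k : Ordinal.{u}), p (ω ^ (k : Ordinal.{u}) * n + r) := by
      intro n
      induction n with
      | zero => simpa using ih'
      | succ n ihn =>
        intro r hr
        have := hp k (Nat.lt_succ_self k) _ ?_ (ihn r hr)
        · rw [← add_assoc] at this
          rwa [Nat.cast_succ, ← Nat.cast_one, ← Nat.cast_add, Nat.add_comm, Nat.cast_add,
            Nat.cast_one, mul_add, mul_one]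
        · exact omega0_opow_add_lt (omega0_opow_mul_natCast_lt k n)
            (hr.trans (omega0_opow_natCast_lt_iff.2 (Nat.lt_succ_self k)))
    intro x hx
    have hW : ω ^ (k : Ordinal.{u}) ≠ 0 := opow_ne_zero _ omega0_ne_zero
    have hd : x / ω ^ (k : Ordinal.{u}) < ω := by
      rw [← lt_mul_iff_div_lt hW, ← omega0_opow_natCast_succ]
      exact hx
    obtain ⟨n, hn⟩ := lt_omega0.1 hd
    rw [← div_add_mod x (ω ^ (k : Ordinal.{u})), hn]
    exact key n _ (mod_lt x hW)

end Ordinal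

/-! ### Shifts, translates and the natural partial order -/

namespace AlphaBicyclic

variable {α : Ordinal.{u}}

/-- The element `(c, 0)`. -/
def row (c : Ordinal.{u}) (hc : c < ω ^ α) : AlphaBicyclic α :=
  ⟨c, 0, hc, Ordinal.opow_pos α Ordinal.omega0_pos⟩

/-- The element `(0, c)`. -/
def col (c : Ordinal.{u}) (hc : c < ω ^ α) : AlphaBicyclic α :=
  ⟨0, c, Ordinal.opow_pos α Ordinal.omega0_pos, hc⟩

section

variable (c : Ordinal.{u}) (hc : c < ω ^ α) (x : AlphaBicyclic α)

theorem row_mul_fst : (row c hc * x).fst = c + x.fst := by simp [mul_fst, row]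
theorem row_mul_snd : (row c hc * x).snd = x.snd := by simp [mul_snd, row]
theorem col_mul_fst : (col c hc * x).fst = x.fst - c := by simp [mul_fst, col]
theorem col_mul_snd : (col c hc * x).snd = x.snd + (c - x.fst) := by simp [mul_snd, col]
theorem mul_row_fst : (x * row c hc).fst = x.fst + (c - x.snd) := by simp [mul_fst, row]
theorem mul_row_snd : (x * row c hc).snd = x.snd - c := by simp [mul_snd, row]
theorem mul_col_fst : (x * col c hc).fst = x.fst := by simp [mul_fst, col]
theorem mul_col_snd : (x * col c hc).snd = c + x.snd := by simp [mul_snd, col]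

end

theorem row_mul_col (x : AlphaBicyclic α) : row x.fst x.fst_lt * col x.snd x.snd_lt = x := by
  ext
  · rw [mul_col_fst, row]
  · rw [mul_col_snd, row, add_zero]

/-- The shift `(x, y) ↦ (A + x, B + y)`. -/
noncomputable def embed (A B : Ordinal.{u}) (hA : A < ω ^ α) (hB : B < ω ^ α)
    (x : AlphaBicyclic α) : AlphaBicyclic α :=
  row A hA * x * col B hB

/-- The shift that is a left inverse of `embed A B`. -/
noncomputable def retract (A B : Ordinal.{u}) (hA : A < ω ^ α) (hB : B < ω ^ α)
    (x : AlphaBicyclic α) : AlphaBicyclic α :=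
  col A hA * x * row B hB

section

variable (A B : Ordinal.{u}) (hA : A < ω ^ α) (hB : B < ω ^ α) (x : AlphaBicyclic α)

theorem embed_fst : (embed A B hA hB x).fst = A + x.fst := by
  rw [embed, mul_col_fst, row_mul_fst]

theorem embed_snd : (embed A B hA hB x).snd = B + x.snd := by
  rw [embed, mul_col_snd, row_mul_snd]

theorem retract_fst :
    (retract A B hA hB x).fst = x.fst - A + (B - (x.snd + (A - x.fst))) := by
  rw [retract, mul_row_fst, col_mul_fst, col_mul_snd]

theorem retract_snd :
    (retract A B hA hB x).snd = x.snd + (A - x.fst) - B := by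
  rw [retract, mul_row_snd, col_mul_snd]

theorem retract_embed : retract A B hA hB (embed A B hA hB x) = x := by
  ext
  · rw [retract_fst, embed_fst, embed_snd, Ordinal.add_sub_cancel,
      Ordinal.sub_eq_zero_iff_le.2 (le_self_add : A ≤ A + x.fst), add_zero,
      Ordinal.sub_eq_zero_iff_le.2 (le_self_add : B ≤ B + x.snd), add_zero]
  · rw [retract_snd, embed_fst, embed_snd,
      Ordinal.sub_eq_zero_iff_le.2 (le_self_add : A ≤ A + x.fst), add_zero,
      Ordinal.add_sub_cancel]

theorem embed_retract {x : AlphaBicyclic α} (hxA : A ≤ x.fst) (hxB : B ≤ x.snd) :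
    embed A B hA hB (retract A B hA hB x) = x := by
  have h : x.snd + (A - x.fst) = x.snd := by
    rw [Ordinal.sub_eq_zero_iff_le.2 hxA, add_zero]
  ext
  · rw [embed_fst, retract_fst, h, Ordinal.sub_eq_zero_iff_le.2 hxB, add_zero,
      Ordinal.add_sub_cancel_of_le hxA]
  · rw [embed_snd, retract_snd, h, Ordinal.add_sub_cancel_of_le hxB]

end

/-- The set of elements above `q` in the natural partial order. -/
def up (q : AlphaBicyclic α) : Set (AlphaBicyclic α) :=
  {x | ∃ v, x.fst + v = q.fst ∧ x.snd + v = q.snd}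

theorem self_mem_up (q : AlphaBicyclic α) : q ∈ up q := ⟨0, by simp, by simp⟩

theorem fst_le_of_mem_up {q x : AlphaBicyclic α} (h : x ∈ up q) : x.fst ≤ q.fst := by
  obtain ⟨v, hv, -⟩ := h
  exact hv ▸ le_self_add

theorem snd_le_of_mem_up {q x : AlphaBicyclic α} (h : x ∈ up q) : x.snd ≤ q.snd := by
  obtain ⟨v, -, hv⟩ := h
  exact hv ▸ le_self_add

theorem up_antisymm {q x : AlphaBicyclic α} (h : x ∈ up q) (h' : q ∈ up x) : x = q :=
  AlphaBicyclic.ext ((fst_le_of_mem_up h).antisymm (fst_le_of_mem_up h'))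
    ((snd_le_of_mem_up h).antisymm (snd_le_of_mem_up h'))

/-- Expresses the order relation as a fiber of a shift; this is what makes `up q` clopen once 1 is
isolated. -/
theorem retract_eq_one_iff {q x : AlphaBicyclic α} :
    retract q.fst q.snd q.fst_lt q.snd_lt x = 1 ↔ x ∈ up q := by
  rw [AlphaBicyclic.ext_iff, retract_fst, retract_snd, one_fst, one_snd, Ordinal.add_eq_zero_iff,
    Ordinal.sub_eq_zero_iff_le, Ordinal.sub_eq_zero_iff_le, Ordinal.sub_eq_zero_iff_le]
  constructor
  · rintro ⟨⟨h1, h2⟩, h3⟩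
    exact ⟨q.fst - x.fst, Ordinal.add_sub_cancel_of_le h1, h3.antisymm h2⟩
  · rintro ⟨v, h1, h2⟩
    have : q.fst - x.fst = v := by rw [← h1, Ordinal.add_sub_cancel]
    rw [this, h2]
    exact ⟨⟨h1 ▸ le_self_add, le_rfl⟩, le_rfl⟩

theorem diag_fst (j : ℕ) (hj : (j : Ordinal.{u}) < α) : (diag j hj).fst = ω ^ (j : Ordinal.{u}) :=
  rfl

theorem diag_snd (j : ℕ) (hj : (j : Ordinal.{u}) < α) : (diag j hj).snd = ω ^ (j : Ordinal.{u}) :=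
  rfl

theorem lt_of_mem_up_diag {j : ℕ} {hj : (j : Ordinal.{u}) < α} {x : AlphaBicyclic α}
    (h : x ∈ up (diag j hj)) (hx : x ≠ diag j hj) :
    x.fst < ω ^ (j : Ordinal.{u}) ∧ x.snd < ω ^ (j : Ordinal.{u}) := by
  obtain ⟨v, h1, h2⟩ := h
  rw [diag_fst] at h1
  rw [diag_snd] at h2
  have hv : v ≠ 0 := by
    rintro rfl
    rw [add_zero] at h1 h2
    exact hx (AlphaBicyclic.ext h1 h2)
  refine ⟨?_, ?_⟩
  · rw [← h1]
    exact lt_add_of_pos_right _ (pos_iff_ne_zero.2 hv)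
  · rw [← h2]
    exact lt_add_of_pos_right _ (pos_iff_ne_zero.2 hv)

theorem mem_up_diag_of_lt {j : ℕ} {hj : (j : Ordinal.{u}) < α} {x : AlphaBicyclic α}
    (h1 : x.fst < ω ^ (j : Ordinal.{u})) (h2 : x.snd < ω ^ (j : Ordinal.{u})) :
    x ∈ up (diag j hj) :=
  ⟨ω ^ (j : Ordinal.{u}), Ordinal.add_omega0_opow h1, Ordinal.add_omega0_opow h2⟩

theorem opow_lt_of_lt {j : ℕ} (hj : (j : Ordinal.{u}) < α) :
    ω ^ (j : Ordinal.{u}) < ω ^ α :=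
  (Ordinal.opow_lt_opow_iff_right Ordinal.one_lt_omega0).2 hj

theorem mem_basicNhd_iff {k : ℕ} {hk : ((k + 1 : ℕ) : Ordinal.{u}) < α} {n : ℕ}
    {x : AlphaBicyclic α} : x ∈ basicNhd (k + 1) hk n ↔
      (x.fst < ω ^ ((k + 1 : ℕ) : Ordinal.{u}) ∧ x.snd < ω ^ ((k + 1 : ℕ) : Ordinal.{u}) ∧
      (ω ^ (k : Ordinal.{u}) * (n : Ordinal.{u}) < x.fst ∨
        ω ^ (k : Ordinal.{u}) * (n : Ordinal.{u}) < x.snd)) ∨ x = diag (k + 1) hk :=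
  Iff.rfl

theorem basicNhd_antitone {j : ℕ} (hj : (j : Ordinal.{u}) < α) {m n : ℕ} (h : m ≤ n) :
    basicNhd j hj n ⊆ basicNhd j hj m := by
  rintro x (⟨h1, h2, h3⟩ | hx)
  · exact .inl ⟨h1, h2, h3.imp (Ordinal.omega0_opow_mul_natCast_le _ h).trans_lt
      (Ordinal.omega0_opow_mul_natCast_le _ h).trans_lt⟩
  · exact .inr hx

theorem basicNhd_subset_up {j : ℕ} (hj : (j : Ordinal.{u}) < α) (n : ℕ) :
    basicNhd j hj n ⊆ up (diag j hj) := by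
  rintro x (⟨h1, h2, -⟩ | rfl)
  · exact mem_up_diag_of_lt h1 h2
  · exact self_mem_up _

/-- An element either has no proper element above it, or is the shift of a diagonal point. -/
theorem up_eq_singleton_or_eq_embed (hα : α ≤ ω) (x : AlphaBicyclic α) :
    up x = {x} ∨ ∃ (s : ℕ) (hs : (s : Ordinal.{u}) < α) (p q : Ordinal.{u})
      (hA : ω ^ (s : Ordinal.{u}) * p < ω ^ α) (hB : ω ^ (s : Ordinal.{u}) * q < ω ^ α),
      x = embed _ _ hA hB (diag s hs) := by
  rw [or_iff_not_imp_left]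
  intro h
  obtain ⟨y, hy, hyx⟩ : ∃ y ∈ up x, y ≠ x := by
    by_contra! h'
    exact h (Set.eq_singleton_iff_unique_mem.2 ⟨self_mem_up x, h'⟩)
  obtain ⟨v, h1, h2⟩ := hy
  have hv : v ≠ 0 := by
    rintro rfl
    rw [add_zero] at h1 h2
    exact hyx (AlphaBicyclic.ext h1 h2)
  have hω : ω ^ α ≤ ω ^ (ω : Ordinal.{u}) := Ordinal.opow_le_opow_right Ordinal.omega0_pos hα
  obtain ⟨s, p, hp⟩ := Ordinal.exists_eq_omega0_opow_mul_succ
    (a := x.fst) (by rw [← h1]; simp [hv]) (x.fst_lt.trans_le hω)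
  obtain ⟨t, q, hq⟩ := Ordinal.exists_eq_omega0_opow_mul_succ
    (a := x.snd) (by rw [← h2]; simp [hv]) (x.snd_lt.trans_le hω)
  -- Both coordinates end in the same nonzero v, so they are divisible by the same powers of ω.
  -- Their last exponents therefore agree, and splitting off the last ω^s exhibits the translate.
  have key : ∀ e : Ordinal.{u}, ω ^ e ∣ x.fst ↔ ω ^ e ∣ x.snd := fun e => by
    rw [← h1, ← h2, Ordinal.omega0_opow_dvd_add_iff hv, Ordinal.omega0_opow_dvd_add_iff hv]
  have hst : s = t := by
    have h3 := key s
    have h4 := key t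
    rw [hp, hq, Ordinal.omega0_opow_dvd_mul_add_one_iff,
      Ordinal.omega0_opow_dvd_mul_add_one_iff] at h3 h4
    omega
  subst hst
  rw [mul_add, mul_one] at hp hq
  have hs : (s : Ordinal.{u}) < α :=
    (Ordinal.opow_lt_opow_iff_right Ordinal.one_lt_omega0).1
      ((le_add_self.trans hp.ge).trans_lt x.fst_lt)
  refine ⟨s, hs, p, q, (le_self_add.trans hp.ge).trans_lt x.fst_lt,
    (le_self_add.trans hq.ge).trans_lt x.snd_lt, AlphaBicyclic.ext ?_ ?_⟩
  · rw [embed_fst, diag_fst, hp]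
  · rw [embed_snd, diag_snd, hq]

section

variable {j : ℕ} (hj : (j : Ordinal.{u}) < α) {c : Ordinal.{u}} (hc : c < ω ^ α)

theorem row_mul_diag (hcj : c < ω ^ (j : Ordinal.{u})) :
    row c hc * diag j hj = diag j hj := by
  ext
  · rw [row_mul_fst, diag_fst, Ordinal.add_omega0_opow hcj]
  · rw [row_mul_snd]

theorem col_mul_diag (hcj : c < ω ^ (j : Ordinal.{u})) :
    col c hc * diag j hj = diag j hj := by
  ext
  · rw [col_mul_fst, diag_fst, Ordinal.omega0_opow_sub hcj]
  · rw [col_mul_snd, diag_fst, Ordinal.sub_eq_zero_iff_le.2 hcj.le, add_zero]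

theorem diag_mul_row (hcj : c < ω ^ (j : Ordinal.{u})) :
    diag j hj * row c hc = diag j hj := by
  ext
  · rw [mul_row_fst, diag_snd, Ordinal.sub_eq_zero_iff_le.2 hcj.le, add_zero]
  · rw [mul_row_snd, diag_snd, Ordinal.omega0_opow_sub hcj]

theorem diag_mul_col (hcj : c < ω ^ (j : Ordinal.{u})) :
    diag j hj * col c hc = diag j hj := by
  ext
  · rw [mul_col_fst]
  · rw [mul_col_snd, diag_snd, Ordinal.add_omega0_opow hcj]

end

/-- Used to see that the range of `embed` is a neighborhood of the translated diagonal point: within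
`up` of that point, only elements above the corner of the translate can fall outside the range. -/
theorem mem_up_embed_diag {s : ℕ} {hs : (s : Ordinal.{u}) < α} {p q : Ordinal.{u}}
    {hA : ω ^ (s : Ordinal.{u}) * p < ω ^ α} {hB : ω ^ (s : Ordinal.{u}) * q < ω ^ α}
    {x : AlphaBicyclic α} (hx : x ∈ up (embed _ _ hA hB (diag s hs))) :
    (ω ^ (s : Ordinal.{u}) * p ≤ x.fst ∧ ω ^ (s : Ordinal.{u}) * q ≤ x.snd) ∨
      x ∈ up ⟨ω ^ (s : Ordinal.{u}) * p, ω ^ (s : Ordinal.{u}) * q, hA, hB⟩ := by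
  have aux : ∀ {a b v p q : Ordinal.{u}},
      a + v = ω ^ (s : Ordinal.{u}) * p + ω ^ (s : Ordinal.{u}) →
      b + v = ω ^ (s : Ordinal.{u}) * q + ω ^ (s : Ordinal.{u}) →
      a < ω ^ (s : Ordinal.{u}) * p →
      ∃ D, a + D = ω ^ (s : Ordinal.{u}) * p ∧ b + D = ω ^ (s : Ordinal.{u}) * q := by
    intro a b v p q h1 h2 h
    obtain ⟨D, hD⟩ := exists_add_of_le h.le
    have hD0 : D ≠ 0 := by
      rintro rfl
      rw [add_zero] at hD
      exact h.ne' hD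
    rw [hD, add_assoc] at h1
    have hv := add_left_cancel h1
    -- Ordinal addition is not right cancellative. Divisibility of b + D by ω^s turns the equation
    -- in `h2` into r + 1 = q + 1, which can be cancelled.
    obtain ⟨r, hr⟩ : ω ^ (s : Ordinal.{u}) ∣ b + D := by
      rw [Ordinal.omega0_opow_dvd_add_iff hD0, ← Ordinal.omega0_opow_dvd_add_iff (x := a) hD0,
        ← hD]
      exact dvd_mul_right _ _
    refine ⟨D, hD.symm, ?_⟩
    rw [hv, ← add_assoc, hr, ← mul_add_one, ← mul_add_one] at h2
    have h3 : r + 1 = q + 1 :=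
      mul_left_cancel₀ (Ordinal.opow_ne_zero _ Ordinal.omega0_ne_zero) h2
    rw [hr, show r = q by simpa using h3]
  obtain ⟨v, h1, h2⟩ := hx
  rw [embed_fst, diag_fst] at h1
  rw [embed_snd, diag_snd] at h2
  rcases lt_or_ge x.fst (ω ^ (s : Ordinal.{u}) * p) with h | h
  · exact .inr (aux h1 h2 h)
  rcases lt_or_ge x.snd (ω ^ (s : Ordinal.{u}) * q) with h' | h'
  · obtain ⟨D, hD1, hD2⟩ := aux h2 h1 h'
    exact .inr ⟨D, hD2, hD1⟩
  · exact .inl ⟨h, h'⟩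

/-! ### Consequences of shift-continuity -/

section Topology

variable [τ : TopologicalSpace (AlphaBicyclic α)]

theorem _root_.IsShiftContinuous.continuous_mul_left {S : Type*} [Monoid S]
    {σ : TopologicalSpace S} (hs : IsShiftContinuous σ) (a : S) : Continuous (a * ·) := by
  simpa using hs a 1

theorem _root_.IsShiftContinuous.continuous_mul_right {S : Type*} [Monoid S]
    {σ : TopologicalSpace S} (hs : IsShiftContinuous σ) (a : S) : Continuous (· * a) := by
  simpa using hs 1 a

/-- Left multiplication by the idempotent (c, c) fixes exactly the elements with first coordinate at
least c, and a fixed-point set is closed in a Hausdorff space. -/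
theorem isOpen_fst_lt [T2Space (AlphaBicyclic α)] (hs : IsShiftContinuous τ) (c : Ordinal.{u}) :
    IsOpen {x : AlphaBicyclic α | x.fst < c} := by
  by_cases hc : c < ω ^ α
  · let e : AlphaBicyclic α := ⟨c, c, hc, hc⟩
    have : {x : AlphaBicyclic α | x.fst < c} = {x | e * x = x}ᶜ := by
      ext x
      rw [Set.mem_compl_iff, Set.mem_ofPred_eq, Set.mem_ofPred_eq, ← not_le, not_iff_not]
      constructor
      · intro h
        ext
        · rw [mul_fst, Ordinal.add_sub_cancel_of_le h]
        · rw [mul_snd, Ordinal.sub_eq_zero_iff_le.2 h, add_zero]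
      · intro h
        rw [← h, mul_fst]
        exact le_self_add
    rw [this, isOpen_compl_iff]
    exact isClosed_eq (hs.continuous_mul_left e) continuous_id
  · convert isOpen_univ
    ext x
    simpa using x.fst_lt.trans_le (not_lt.1 hc)

theorem isOpen_snd_lt [T2Space (AlphaBicyclic α)] (hs : IsShiftContinuous τ) (c : Ordinal.{u}) :
    IsOpen {x : AlphaBicyclic α | x.snd < c} := by
  by_cases hc : c < ω ^ α
  · let e : AlphaBicyclic α := ⟨c, c, hc, hc⟩
    have : {x : AlphaBicyclic α | x.snd < c} = {x | x * e = x}ᶜ := by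
      ext x
      rw [Set.mem_compl_iff, Set.mem_ofPred_eq, Set.mem_ofPred_eq, ← not_le, not_iff_not]
      constructor
      · intro h
        ext
        · rw [mul_fst, Ordinal.sub_eq_zero_iff_le.2 h, add_zero]
        · rw [mul_snd, Ordinal.add_sub_cancel_of_le h]
      · intro h
        rw [← h, mul_snd]
        exact le_self_add
    rw [this, isOpen_compl_iff]
    exact isClosed_eq (hs.continuous_mul_right e) continuous_id
  · convert isOpen_univ
    ext x
    simpa using x.snd_lt.trans_le (not_lt.1 hc)

theorem isOpen_singleton_one [T2Space (AlphaBicyclic α)] (hs : IsShiftContinuous τ) :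
    IsOpen {(1 : AlphaBicyclic α)} := by
  convert (isOpen_fst_lt hs 1).inter (isOpen_snd_lt hs 1)
  ext x
  simp [AlphaBicyclic.ext_iff, one_fst, one_snd]

theorem isClopen_up [T1Space (AlphaBicyclic α)] (hs : IsShiftContinuous τ)
    (h1 : IsOpen {(1 : AlphaBicyclic α)}) (q : AlphaBicyclic α) : IsClopen (up q) := by
  have : up q = retract q.fst q.snd q.fst_lt q.snd_lt ⁻¹' {1} := by
    ext x
    exact retract_eq_one_iff.symm
  rw [this]
  exact IsClopen.preimage ⟨isClosed_singleton, h1⟩ (hs _ _)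

/-- The shift `retract c c` fixes the diagonal point but maps the square of side c to a finite set
avoiding it. The preimage of the complement of that finite set is an open neighborhood missing the
square. -/
theorem basicNhd_mem_nhds [T1Space (AlphaBicyclic α)] (hs : IsShiftContinuous τ)
    (h1 : IsOpen {(1 : AlphaBicyclic α)}) {k : ℕ} (hk : ((k + 1 : ℕ) : Ordinal.{u}) < α) (n : ℕ) :
    basicNhd (k + 1) hk n ∈ 𝓝 (diag (k + 1) hk) := by
  set c : Ordinal.{u} := ω ^ (k : Ordinal.{u}) * n
  have hcj : c < ω ^ ((k + 1 : ℕ) : Ordinal.{u}) := Ordinal.omega0_opow_mul_natCast_lt k n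
  have hc : c < ω ^ α := hcj.trans (opow_lt_of_lt hk)
  have hfst : ∀ x : AlphaBicyclic α, x.fst ≤ c →
      (retract c c hc hc x).fst = (c - x.snd) - (c - x.fst) := fun x hx => by
    rw [retract_fst, Ordinal.sub_eq_zero_iff_le.2 hx, zero_add, Ordinal.sub_sub]
  have hsnd : ∀ x : AlphaBicyclic α, x.snd ≤ c →
      (retract c c hc hc x).snd = (c - x.fst) - (c - x.snd) := fun x hx => by
    rw [retract_snd, ← Ordinal.add_sub_add_cancel x.snd (c - x.fst) (c - x.snd),
      Ordinal.add_sub_cancel_of_le hx]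
  -- By `hfst` and `hsnd` the coordinates on Z are differences of two final segments of c, and c has
  -- finitely many final segments.
  set Z := retract c c hc hc '' {x | x.fst ≤ c ∧ x.snd ≤ c}
  have hZ : Z.Finite := by
    have hR := Ordinal.finite_range_sub_left c
    refine Set.Finite.of_finite_image (f := fun x => (x.fst, x.snd))
      (((hR.image2 (· - ·) hR).prod (hR.image2 (· - ·) hR)).subset ?_) ?_
    · rintro _ ⟨_, ⟨x, ⟨hx1, hx2⟩, rfl⟩, rfl⟩
      refine ⟨?_, ?_⟩
      · change (retract c c hc hc x).fst ∈ _
        rw [hfst x hx1]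
        exact ⟨_, ⟨_, rfl⟩, _, ⟨_, rfl⟩, rfl⟩
      · change (retract c c hc hc x).snd ∈ _
        rw [hsnd x hx2]
        exact ⟨_, ⟨_, rfl⟩, _, ⟨_, rfl⟩, rfl⟩
    · intro x _ y _ h
      rw [Prod.mk.injEq] at h
      exact AlphaBicyclic.ext h.1 h.2
  have hp : retract c c hc hc (diag (k + 1) hk) = diag (k + 1) hk := by
    rw [retract, col_mul_diag hk hc hcj, diag_mul_row hk hc hcj]
  have hpZ : diag (k + 1) hk ∉ Z := by
    rintro ⟨x, ⟨hx1, -⟩, h⟩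
    have := hfst x hx1
    rw [h, diag_fst] at this
    exact absurd (this.le.trans ((Ordinal.sub_le_self _ _).trans (Ordinal.sub_le_self _ _)))
      hcj.not_ge
  have hopen : IsOpen (retract c c hc hc ⁻¹' Zᶜ) :=
    hZ.isClosed.isOpen_compl.preimage (hs _ _)
  filter_upwards [hopen.mem_nhds (show _ ∈ Zᶜ by rwa [hp]),
    (isClopen_up hs h1 (diag (k + 1) hk)).isOpen.mem_nhds (self_mem_up _)] with x hx hx'
  rw [mem_basicNhd_iff, or_iff_not_imp_right]
  intro hxp
  obtain ⟨h2, h3⟩ := lt_of_mem_up_diag hx' hxp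
  refine ⟨h2, h3, ?_⟩
  by_contra! h
  exact hx ⟨x, h, rfl⟩

/-- `embed` is a topological embedding, having a continuous left inverse. Its range contains the
open set `up` of the point minus `up` of the corner. -/
theorem nhds_embed_diag [T1Space (AlphaBicyclic α)] (hs : IsShiftContinuous τ)
    (h1 : IsOpen {(1 : AlphaBicyclic α)}) {s : ℕ} (hs' : (s : Ordinal.{u}) < α)
    {p q : Ordinal.{u}} (hA : ω ^ (s : Ordinal.{u}) * p < ω ^ α)
    (hB : ω ^ (s : Ordinal.{u}) * q < ω ^ α) :
    𝓝 (embed _ _ hA hB (diag s hs')) = Filter.map (embed _ _ hA hB) (𝓝 (diag s hs')) := by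
  have hemb : Topology.IsEmbedding (embed (α := α) _ _ hA hB) :=
    (show Function.LeftInverse (retract _ _ hA hB) (embed _ _ hA hB) from
      retract_embed _ _ hA hB).isEmbedding (hs _ _) (hs _ _)
  refine (hemb.map_nhds_of_mem _ ?_).symm
  set r : AlphaBicyclic α := ⟨ω ^ (s : Ordinal.{u}) * p, ω ^ (s : Ordinal.{u}) * q, hA, hB⟩
  have hr : embed _ _ hA hB (diag s hs') ∉ up r := fun h => by
    have := fst_le_of_mem_up h
    rw [embed_fst, diag_fst] at this
    exact absurd (lt_add_of_pos_right _ (Ordinal.opow_pos _ Ordinal.omega0_pos)) this.not_gt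
  filter_upwards [(isClopen_up hs h1 _).isOpen.mem_nhds (self_mem_up _),
    (isClopen_up hs h1 r).compl.isOpen.mem_nhds hr] with x hx hx'
  rcases mem_up_embed_diag hx with ⟨h2, h3⟩ | h
  · exact ⟨_, embed_retract _ _ hA hB h2 h3⟩
  · exact absurd h hx'

theorem isOpen_singleton_of_up_eq [T1Space (AlphaBicyclic α)] (hs : IsShiftContinuous τ)
    (h1 : IsOpen {(1 : AlphaBicyclic α)}) {x : AlphaBicyclic α} (hx : up x = {x}) :
    IsOpen {x} :=
  hx ▸ (isClopen_up hs h1 x).isOpen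

theorem isOpen_singleton_diag_zero [T1Space (AlphaBicyclic α)] (hs : IsShiftContinuous τ)
    (h1 : IsOpen {(1 : AlphaBicyclic α)}) (h0 : ((0 : ℕ) : Ordinal.{u}) < α) :
    IsOpen {diag 0 h0} := by
  convert (isClopen_up hs h1 (diag 0 h0)).isOpen.inter (isClosed_singleton (x := 1)).isOpen_compl
  ext x
  constructor
  · rintro rfl
    refine ⟨self_mem_up _, fun h => ?_⟩
    have := congrArg AlphaBicyclic.fst h
    rw [diag_fst, one_fst] at this
    exact Ordinal.opow_ne_zero _ Ordinal.omega0_ne_zero this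
  · rintro ⟨hx, hx'⟩
    by_contra hne
    obtain ⟨h2, h3⟩ := lt_of_mem_up_diag hx hne
    rw [Nat.cast_zero, Ordinal.opow_zero, Order.lt_one_iff] at h2 h3
    exact hx' (AlphaBicyclic.ext h2 h3)

end Topology

/-- A Hausdorff shift-continuous topology on `𝓑_α`, `α ≤ ω`, is determined by the neighborhoods
of the points `(ω^j, ω^j)`, `1 ≤ j < α`. -/
theorem le_of_nhds_diag_le (hα : α ≤ ω) {σ τ : TopologicalSpace (AlphaBicyclic α)}
    (hσ2 : @T2Space _ σ) (hσ : IsShiftContinuous σ)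
    (hτ2 : @T2Space _ τ) (hτ : IsShiftContinuous τ)
    (h : ∀ (j : ℕ) (hj : (j : Ordinal.{u}) < α), 1 ≤ j →
      @nhds _ σ (diag j hj) ≤ @nhds _ τ (diag j hj)) : σ ≤ τ := by
  have hσ1 := @isOpen_singleton_one α σ hσ2 hσ
  have hτ1 := @isOpen_singleton_one α τ hτ2 hτ
  have hσT := @T2Space.t1Space _ σ hσ2
  have hτT := @T2Space.t1Space _ τ hτ2
  have hpure : ∀ x : AlphaBicyclic α, IsOpen[σ] {x} → @nhds _ σ x ≤ @nhds _ τ x := by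
    intro x hx
    rw [(@isOpen_singleton_iff_nhds_eq_pure _ σ x).1 hx]
    exact @pure_le_nhds _ τ x
  rw [le_iff_nhds]
  intro x
  rcases up_eq_singleton_or_eq_embed hα x with hx | ⟨s, hs, p, q, hA, hB, rfl⟩
  · exact hpure x (@isOpen_singleton_of_up_eq α σ hσT hσ hσ1 x hx)
  · rw [@nhds_embed_diag α σ hσT hσ hσ1 s hs p q hA hB,
      @nhds_embed_diag α τ hτT hτ hτ1 s hs p q hA hB]
    refine Filter.map_mono ?_
    rcases Nat.eq_zero_or_pos s with rfl | hpos
    · exact hpure _ (@isOpen_singleton_diag_zero α σ hσT hσ hσ1 hs)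
    · exact h s hs hpos

end AlphaBicyclic

/-- A relation on the ordinals below `ω ^ (k + 1)` that is preserved, outside the square of side
`ω ^ k * N`, by the shifts of the bicyclic monoid by powers of `ω`. -/
structure IsTailInvariant (k N : ℕ) (P : Ordinal.{u} → Ordinal.{u} → Prop) : Prop where
  add_left : ∀ i < k + 1, ∀ x < ω ^ ((k + 1 : ℕ) : Ordinal.{u}),
    ∀ y < ω ^ ((k + 1 : ℕ) : Ordinal.{u}),
    (ω ^ (k : Ordinal.{u}) * N < x ∨ ω ^ (k : Ordinal.{u}) * N < y) →
    P x y → P (ω ^ (i : Ordinal.{u}) + x) y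
  add_right : ∀ i < k + 1, ∀ x < ω ^ ((k + 1 : ℕ) : Ordinal.{u}),
    ∀ y < ω ^ ((k + 1 : ℕ) : Ordinal.{u}),
    (ω ^ (k : Ordinal.{u}) * N < x ∨ ω ^ (k : Ordinal.{u}) * N < y) →
    P x y → P x (ω ^ (i : Ordinal.{u}) + y)
  sub_left : ∀ x < ω ^ ((k + 1 : ℕ) : Ordinal.{u}), ∀ y < ω ^ ((k + 1 : ℕ) : Ordinal.{u}),
    (ω ^ (k : Ordinal.{u}) * N < x ∨ ω ^ (k : Ordinal.{u}) * N < y) →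
    P x y → P (x - ω ^ (k : Ordinal.{u})) (y + (ω ^ (k : Ordinal.{u}) - x))
  sub_right : ∀ x < ω ^ ((k + 1 : ℕ) : Ordinal.{u}), ∀ y < ω ^ ((k + 1 : ℕ) : Ordinal.{u}),
    (ω ^ (k : Ordinal.{u}) * N < x ∨ ω ^ (k : Ordinal.{u}) * N < y) →
    P x y → P (x + (ω ^ (k : Ordinal.{u}) - y)) (y - ω ^ (k : Ordinal.{u}))

/-! ### Propagation of tail-invariant relations -/

namespace IsTailInvariant

variable {k N : ℕ} {P : Ordinal.{u} → Ordinal.{u} → Prop}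

theorem swap (h : IsTailInvariant k N P) : IsTailInvariant k N fun x y => P y x where
  add_left i hi x hx y hy hxy := h.add_right i hi y hy x hx hxy.symm
  add_right i hi x hx y hy hxy := h.add_left i hi y hy x hx hxy.symm
  sub_left x hx y hy hxy := h.sub_right y hy x hx hxy.symm
  sub_right x hx y hy hxy := h.sub_left y hy x hx hxy.symm

theorem fill_left (h : IsTailInvariant k N P) {y : Ordinal.{u}}
    (hy : y < ω ^ ((k + 1 : ℕ) : Ordinal.{u})) (hNy : ω ^ (k : Ordinal.{u}) * N < y)
    (h0 : P 0 y) : ∀ x < ω ^ ((k + 1 : ℕ) : Ordinal.{u}), P x y :=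
  Ordinal.omega0_opow_induction (k + 1) h0 fun i hi x hx hp =>
    h.add_left i hi x hx y hy (.inr hNy) hp

theorem mul_succ_eq (m : ℕ) (r : Ordinal.{u}) : ω ^ (k : Ordinal.{u}) * ((m + 1 : ℕ) : Ordinal.{u})
    + r = ω ^ (k : Ordinal.{u}) + (ω ^ (k : Ordinal.{u}) * m + r) := by
  rw [Nat.add_comm, Nat.cast_add, Nat.cast_one, mul_add, mul_one, add_assoc]

theorem sub_left_mul_succ (h : IsTailInvariant k N P) {y : Ordinal.{u}}
    (hy : y < ω ^ ((k + 1 : ℕ) : Ordinal.{u})) (hNy : ω ^ (k : Ordinal.{u}) * N < y)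
    {m : ℕ} {r : Ordinal.{u}} (hr : r < ω ^ (k : Ordinal.{u}))
    (hp : P (ω ^ (k : Ordinal.{u}) * ((m + 1 : ℕ) : Ordinal.{u}) + r) y) :
    P (ω ^ (k : Ordinal.{u}) * m + r) y := by
  have := h.sub_left _ (Ordinal.omega0_opow_add_lt (Ordinal.omega0_opow_mul_natCast_lt k (m + 1))
    (hr.trans (Ordinal.omega0_opow_natCast_lt_iff.2 (Nat.lt_succ_self k)))) y hy (.inr hNy) hp
  rwa [mul_succ_eq, Ordinal.add_sub_cancel, Ordinal.sub_eq_zero_iff_le.2 le_self_add,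
    add_zero] at this

theorem sub_left_iterate (h : IsTailInvariant k N P) {y : Ordinal.{u}}
    (hy : y < ω ^ ((k + 1 : ℕ) : Ordinal.{u})) (hNy : ω ^ (k : Ordinal.{u}) * N < y)
    (m : ℕ) {r : Ordinal.{u}} (hr : r < ω ^ (k : Ordinal.{u}))
    (hp : P (ω ^ (k : Ordinal.{u}) * m + r) y) : P r y := by
  induction m with
  | zero => simpa using hp
  | succ m ih => exact ih (h.sub_left_mul_succ hy hNy hr hp)

theorem reduce_left_mul (h : IsTailInvariant k N P) {y : Ordinal.{u}}
    (hy : y < ω ^ ((k + 1 : ℕ) : Ordinal.{u})) (hNy : ω ^ (k : Ordinal.{u}) * N < y)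
    (m : ℕ) (hp : P (ω ^ (k : Ordinal.{u}) * m) y) : P 0 y :=
  h.sub_left_iterate hy hNy m (Ordinal.opow_pos _ Ordinal.omega0_pos) (by rwa [add_zero])

/-- Subtracting ω^k repeatedly brings x down to its remainder r < ω^k. One more step sends r to 0
and adds ω^k - r = ω^k to y. -/
theorem reduce_left (h : IsTailInvariant k N P) {x y : Ordinal.{u}}
    (hx : x < ω ^ ((k + 1 : ℕ) : Ordinal.{u}))
    (hy : y < ω ^ ((k + 1 : ℕ) : Ordinal.{u})) (hNy : ω ^ (k : Ordinal.{u}) * N < y)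
    (hp : P x y) : P 0 (y + ω ^ (k : Ordinal.{u})) := by
  have hW : ω ^ (k : Ordinal.{u}) ≠ 0 := Ordinal.opow_ne_zero _ Ordinal.omega0_ne_zero
  have hd : x / ω ^ (k : Ordinal.{u}) < ω := by
    rw [← Ordinal.lt_mul_iff_div_lt hW, ← Ordinal.omega0_opow_natCast_succ]
    exact hx
  obtain ⟨m, hm⟩ := Ordinal.lt_omega0.1 hd
  rw [← Ordinal.div_add_mod x (ω ^ (k : Ordinal.{u})), hm] at hp
  have hr := Ordinal.mod_lt x hW
  have := h.sub_left _ (hr.trans (Ordinal.omega0_opow_natCast_lt_iff.2 (Nat.lt_succ_self k)))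
    y hy (.inr hNy) (h.sub_left_iterate hy hNy m hr hp)
  rwa [Ordinal.sub_eq_zero_iff_le.2 hr.le, Ordinal.omega0_opow_sub hr] at this

theorem mul_lt_mul_succ {m n : ℕ} (h : m < n) :
    ω ^ (k : Ordinal.{u}) * (m : Ordinal.{u}) < ω ^ (k : Ordinal.{u}) * (n : Ordinal.{u}) :=
  mul_lt_mul_of_pos_left (by exact_mod_cast h) (Ordinal.opow_pos _ Ordinal.omega0_pos)

/-- A tail-invariant relation that holds at some point outside the square of side `ω ^ k * N`
holds everywhere outside this square. -/
theorem forall_of_exists (h : IsTailInvariant k N P)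
    (hex : ∃ x < ω ^ ((k + 1 : ℕ) : Ordinal.{u}), ∃ y < ω ^ ((k + 1 : ℕ) : Ordinal.{u}),
      (ω ^ (k : Ordinal.{u}) * N < x ∨ ω ^ (k : Ordinal.{u}) * N < y) ∧ P x y) :
    ∀ x < ω ^ ((k + 1 : ℕ) : Ordinal.{u}), ∀ y < ω ^ ((k + 1 : ℕ) : Ordinal.{u}),
      (ω ^ (k : Ordinal.{u}) * N < x ∨ ω ^ (k : Ordinal.{u}) * N < y) → P x y := by
  have hWlt : ω ^ (k : Ordinal.{u}) < ω ^ ((k + 1 : ℕ) : Ordinal.{u}) :=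
    Ordinal.omega0_opow_natCast_lt_iff.2 (Nat.lt_succ_self k)
  have hmul := Ordinal.omega0_opow_mul_natCast_lt.{u} k
  have hN1 := mul_lt_mul_succ.{u} (k := k) (Nat.lt_succ_self N)
  have add_lt : ∀ z < ω ^ ((k + 1 : ℕ) : Ordinal.{u}),
      z + ω ^ (k : Ordinal.{u}) < ω ^ ((k + 1 : ℕ) : Ordinal.{u}) :=
    fun z hz => Ordinal.omega0_opow_add_lt hz hWlt
  -- A point on the edge x = 0 with y beyond the square is found first. If only x is known to be
  -- large, y is reduced to 0, refilled to ω^k (N + 1), and then x is reduced.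
  have start : ∃ y < ω ^ ((k + 1 : ℕ) : Ordinal.{u}), ω ^ (k : Ordinal.{u}) * N < y ∧ P 0 y := by
    obtain ⟨x, hx, y, hy, hxy | hxy, hp⟩ := hex
    · have h0 : P (x + ω ^ (k : Ordinal.{u})) 0 := h.swap.reduce_left hy hx hxy hp
      have h1 : P (x + ω ^ (k : Ordinal.{u})) (ω ^ (k : Ordinal.{u}) * (N + 1 : ℕ)) :=
        h.swap.fill_left (add_lt x hx) (hxy.trans_le le_self_add) h0 _ (hmul _)
      exact ⟨_, add_lt _ (hmul _), hN1.trans_le le_self_add,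
        h.reduce_left (add_lt x hx) (hmul _) hN1 h1⟩
    · exact ⟨_, add_lt y hy, hxy.trans_le le_self_add, h.reduce_left hx hy hxy hp⟩
  obtain ⟨y, hy, hNy, hp⟩ := start
  have h1 : P (ω ^ (k : Ordinal.{u}) * (N + 1 : ℕ) + ω ^ (k : Ordinal.{u})) 0 :=
    h.swap.reduce_left hy (hmul _) hN1 (h.fill_left hy hNy hp _ (hmul _))
  rw [← mul_add_one, ← Nat.cast_succ] at h1
  -- This column has a multiple of ω^k as abscissa, so `reduce_left_mul` can go from it to x = 0
  -- without raising y. Hence every y beyond the square is reached exactly.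
  have h2 : ∀ y < ω ^ ((k + 1 : ℕ) : Ordinal.{u}), P (ω ^ (k : Ordinal.{u}) * (N + 2 : ℕ)) y :=
    h.swap.fill_left (hmul _) (mul_lt_mul_succ (by omega)) h1
  have h3 : ∀ x < ω ^ ((k + 1 : ℕ) : Ordinal.{u}), ∀ y < ω ^ ((k + 1 : ℕ) : Ordinal.{u}),
      ω ^ (k : Ordinal.{u}) * N < y → P x y := fun x hx y hy hNy =>
    h.fill_left hy hNy (h.reduce_left_mul hy hNy _ (h2 y hy)) x hx
  rintro x hx y hy (hxy | hxy)
  · exact h.swap.fill_left hx hxy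
      (h.swap.reduce_left_mul hx hxy _ (h3 x hx _ (hmul (N + 1)) hN1)) y hy
  · exact h3 x hx y hy hxy

end IsTailInvariant

namespace AlphaBicyclic

variable {α : Ordinal.{u}}

/-! ### Neighborhoods of diagonal points under local compactness -/

section LocallyCompact

variable [τ : TopologicalSpace (AlphaBicyclic α)] [T2Space (AlphaBicyclic α)]

/-- The part of K outside the interior of V is compact and misses the diagonal point, so it is
covered by an increasing sequence of open squares, hence by one of them. -/
theorem exists_le_of_notMem_nhds (hs : IsShiftContinuous τ) {k : ℕ}
    (hk : ((k + 1 : ℕ) : Ordinal.{u}) < α) {K V : Set (AlphaBicyclic α)} (hK : IsCompact K)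
    (hKp : K ⊆ up (diag (k + 1) hk)) (hV : V ∈ 𝓝 (diag (k + 1) hk)) :
    ∃ N : ℕ, ∀ x ∈ K, x ∉ V →
      x.fst ≤ ω ^ (k : Ordinal.{u}) * N ∧ x.snd ≤ ω ^ (k : Ordinal.{u}) * N := by
  let U : ℕ → Set (AlphaBicyclic α) := fun n =>
    {x | x.fst < ω ^ (k : Ordinal.{u}) * n} ∩ {x | x.snd < ω ^ (k : Ordinal.{u}) * n}
  have hU : Monotone U := fun m n h x hx =>
    ⟨lt_of_lt_of_le hx.1 (Ordinal.omega0_opow_mul_natCast_le k h),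
      lt_of_lt_of_le hx.2 (Ordinal.omega0_opow_mul_natCast_le k h)⟩
  obtain ⟨N, hN⟩ := (hK.diff (isOpen_interior (s := V))).elim_directed_cover U
    (fun n => (isOpen_fst_lt hs _).inter (isOpen_snd_lt hs _)) (fun x hx => by
      have hxp : x ≠ diag (k + 1) hk := by
        rintro rfl
        exact hx.2 (mem_interior_iff_mem_nhds.2 hV)
      obtain ⟨h1, h2⟩ := lt_of_mem_up_diag (hKp hx.1) hxp
      obtain ⟨m, hm⟩ := Ordinal.lt_omega0_opow_natCast_succ.1 h1
      obtain ⟨n, hn⟩ := Ordinal.lt_omega0_opow_natCast_succ.1 h2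
      exact Set.mem_iUnion.2 ⟨max m n,
        hm.trans_le (Ordinal.omega0_opow_mul_natCast_le k (le_max_left m n)),
        hn.trans_le (Ordinal.omega0_opow_mul_natCast_le k (le_max_right m n))⟩)
    hU.directed_le
  refine ⟨N, fun x hx hxV => ?_⟩
  have := hN ⟨hx, fun h => hxV (interior_subset h)⟩
  exact ⟨this.1.le, this.2.le⟩

/-- The finitely many shifts involved fix the diagonal point, so by continuity they send all points
near it into K. The exceptions in K lie in one square. -/
theorem exists_isTailInvariant (hs : IsShiftContinuous τ) {k : ℕ}
    (hk : ((k + 1 : ℕ) : Ordinal.{u}) < α) {K : Set (AlphaBicyclic α)} (hK : IsCompact K)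
    (hKp : K ⊆ up (diag (k + 1) hk)) (hKn : K ∈ 𝓝 (diag (k + 1) hk)) :
    ∃ N : ℕ, IsTailInvariant k N fun x y => ∃ z ∈ K, z.fst = x ∧ z.snd = y := by
  have hlt : ∀ i < k + 1, ω ^ (i : Ordinal.{u}) < ω ^ ((k + 1 : ℕ) : Ordinal.{u}) :=
    fun i hi => Ordinal.omega0_opow_natCast_lt_iff.2 hi
  have hα : ∀ i < k + 1, ω ^ (i : Ordinal.{u}) < ω ^ α :=
    fun i hi => (hlt i hi).trans (opow_lt_of_lt hk)
  have hleft : ∀ a : AlphaBicyclic α, a * diag (k + 1) hk = diag (k + 1) hk →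
      ∀ᶠ x in 𝓝 (diag (k + 1) hk), a * x ∈ K := fun a ha =>
    (hs.continuous_mul_left a).continuousAt.eventually_mem (by rwa [ha])
  have hright : ∀ a : AlphaBicyclic α, diag (k + 1) hk * a = diag (k + 1) hk →
      ∀ᶠ x in 𝓝 (diag (k + 1) hk), x * a ∈ K := fun a ha =>
    (hs.continuous_mul_right a).continuousAt.eventually_mem (by rwa [ha])
  have hV : ∀ᶠ x in 𝓝 (diag (k + 1) hk),
      ((∀ i : Fin (k + 1), row _ (hα i i.2) * x ∈ K) ∧ ∀ i : Fin (k + 1),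
        x * col _ (hα i i.2) ∈ K) ∧ col _ (hα k k.lt_succ_self) * x ∈ K ∧
        x * row _ (hα k k.lt_succ_self) ∈ K :=
    ((Filter.eventually_all.2 fun i : Fin (k + 1) => hleft _ (row_mul_diag hk _ (hlt i i.2))).and
      (Filter.eventually_all.2 fun i : Fin (k + 1) => hright _ (diag_mul_col hk _ (hlt i i.2)))).and
      ((hleft _ (col_mul_diag hk _ (hlt k k.lt_succ_self))).and
      (hright _ (diag_mul_row hk _ (hlt k k.lt_succ_self))))
  obtain ⟨N, hN⟩ := exists_le_of_notMem_nhds hs hk hK hKp hV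
  have key : ∀ z ∈ K, (ω ^ (k : Ordinal.{u}) * N < z.fst ∨ ω ^ (k : Ordinal.{u}) * N < z.snd) →
      _ := fun z hz h => by_contra fun h' =>
    h.elim (hN z hz h').1.not_gt (hN z hz h').2.not_gt
  refine ⟨N, ⟨?_, ?_, ?_, ?_⟩⟩
  · rintro i hi _ - _ - h ⟨z, hz, rfl, rfl⟩
    exact ⟨_, (key z hz h).1.1 ⟨i, hi⟩, row_mul_fst _ _ _, row_mul_snd _ _ _⟩
  · rintro i hi _ - _ - h ⟨z, hz, rfl, rfl⟩
    exact ⟨_, (key z hz h).1.2 ⟨i, hi⟩, mul_col_fst _ _ _, mul_col_snd _ _ _⟩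
  · rintro _ - _ - h ⟨z, hz, rfl, rfl⟩
    exact ⟨_, (key z hz h).2.1, col_mul_fst _ _ _, col_mul_snd _ _ _⟩
  · rintro _ - _ - h ⟨z, hz, rfl, rfl⟩
    exact ⟨_, (key z hz h).2.2, mul_row_fst _ _ _, mul_row_snd _ _ _⟩

theorem exists_basicNhd_subset (hs : IsShiftContinuous τ) {k : ℕ}
    (hk : ((k + 1 : ℕ) : Ordinal.{u}) < α) (hiso : ¬ IsOpen {diag (k + 1) hk})
    {K : Set (AlphaBicyclic α)} (hK : IsCompact K)
    (hKp : K ⊆ up (diag (k + 1) hk)) (hKn : K ∈ 𝓝 (diag (k + 1) hk)) :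
    ∃ N : ℕ, basicNhd (k + 1) hk N ⊆ K := by
  obtain ⟨N, hN⟩ := exists_isTailInvariant hs hk hK hKp hKn
  refine ⟨N, ?_⟩
  have hmem := Filter.inter_mem hKn (basicNhd_mem_nhds hs (isOpen_singleton_one hs) hk N)
  obtain ⟨z, ⟨hzK, hzN⟩, hzp⟩ : ∃ z ∈ K ∩ basicNhd (k + 1) hk N, z ≠ diag (k + 1) hk := by
    by_contra! h
    exact hiso (isOpen_singleton_iff_nhds_eq_pure _ |>.2
      (le_antisymm (Filter.le_pure_iff.2 (Filter.mem_of_superset hmem h)) (pure_le_nhds _)))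
  obtain ⟨h1, h2, h3⟩ := (mem_basicNhd_iff.1 hzN).resolve_right hzp
  have hall := hN.forall_of_exists ⟨_, h1, _, h2, h3, z, hzK, rfl, rfl⟩
  rintro x hx
  rcases mem_basicNhd_iff.1 hx with ⟨h1, h2, h3⟩ | rfl
  · obtain ⟨y, hy, hy1, hy2⟩ := hall _ h1 _ h2 h3
    rwa [← AlphaBicyclic.ext hy1 hy2]
  · exact mem_of_mem_nhds hKn

variable [LocallyCompactSpace (AlphaBicyclic α)]

theorem exists_isCompact_subset_up (hs : IsShiftContinuous τ) (q : AlphaBicyclic α) :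
    ∃ K ∈ 𝓝 q, K ⊆ up q ∧ IsCompact K :=
  local_compact_nhds ((isClopen_up hs (isOpen_singleton_one hs) q).isOpen.mem_nhds (self_mem_up q))

/-- A compact K contains everything beyond one square, and K \ V lies in another. So V contains
everything beyond both. -/
theorem hasBasis_nhds_diag (hs : IsShiftContinuous τ) {k : ℕ}
    (hk : ((k + 1 : ℕ) : Ordinal.{u}) < α) (hiso : ¬ IsOpen {diag (k + 1) hk}) :
    (𝓝 (diag (k + 1) hk)).HasBasis (fun n : ℕ => 1 ≤ n) (basicNhd (k + 1) hk) := by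
  refine ⟨fun V => ⟨fun hV => ?_, ?_⟩⟩
  · obtain ⟨K, hKn, hKp, hK⟩ := exists_isCompact_subset_up hs (diag (k + 1) hk)
    obtain ⟨M, hM⟩ := exists_basicNhd_subset hs hk hiso hK hKp hKn
    obtain ⟨N, hN⟩ := exists_le_of_notMem_nhds hs hk hK hKp hV
    refine ⟨max M N + 1, by omega, fun x hx => by_contra fun hxV => ?_⟩
    obtain ⟨h1, h2⟩ := hN x (hM (basicNhd_antitone hk (by omega) hx)) hxV
    rcases mem_basicNhd_iff.1 (basicNhd_antitone hk (show N ≤ max M N + 1 by omega) hx) with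
      ⟨-, -, h | h⟩ | rfl
    · exact h1.not_gt h
    · exact h2.not_gt h
    · exact hxV (mem_of_mem_nhds hV)
  · rintro ⟨n, -, hn⟩
    exact Filter.mem_of_superset (basicNhd_mem_nhds hs (isOpen_singleton_one hs) hk n) hn

/-- Compactness near the higher point, transported by a shift, forces the idempotents (ω^k t, ω^k t)
to accumulate, and their only possible limit is `diag (k + 1)`. -/
theorem not_isOpen_singleton_diag_of_succ (hs : IsShiftContinuous τ) {k : ℕ}
    (hk' : ((k + 1 : ℕ) : Ordinal.{u}) < α)
    (hk : ((k + 1 + 1 : ℕ) : Ordinal.{u}) < α) (hiso : ¬ IsOpen {diag (k + 1 + 1) hk}) :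
    ¬ IsOpen {diag (k + 1) hk'} := by
  intro hopen
  obtain ⟨K, hKn, hKp, hK⟩ := exists_isCompact_subset_up hs (diag (k + 1 + 1) hk)
  obtain ⟨n, hn⟩ := exists_basicNhd_subset hs hk hiso hK hKp hKn
  have hw : ∀ t : ℕ, ω ^ (k : Ordinal.{u}) * t < ω ^ ((k + 1 : ℕ) : Ordinal.{u}) :=
    Ordinal.omega0_opow_mul_natCast_lt k
  have hwj : ω ^ ((k + 1 : ℕ) : Ordinal.{u}) < ω ^ ((k + 1 + 1 : ℕ) : Ordinal.{u}) :=
    Ordinal.omega0_opow_natCast_lt_iff.2 (Nat.lt_succ_self _)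
  have hc : ω ^ ((k + 1 : ℕ) : Ordinal.{u}) * ((n + 1 : ℕ) : Ordinal.{u}) <
      ω ^ ((k + 1 + 1 : ℕ) : Ordinal.{u}) := Ordinal.omega0_opow_mul_natCast_lt (k + 1) (n + 1)
  have hcα := hc.trans (opow_lt_of_lt hk)
  let q : ℕ → AlphaBicyclic α := fun t =>
    ⟨_, _, (hw t).trans (opow_lt_of_lt hk'), (hw t).trans (opow_lt_of_lt hk')⟩
  -- Multiplication by (c, 0), with c = ω^(k+1) (n + 1), moves `q t` into `basicNhd n`, hence into
  -- K; multiplication by (0, c) brings it back.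
  have hq : ∀ t, q t ∈ (col _ hcα * ·) '' K := by
    intro t
    refine ⟨row _ hcα * q t, hn (mem_basicNhd_iff.2 (.inl ⟨?_, ?_, .inl ?_⟩)), ?_⟩
    · rw [row_mul_fst]
      exact Ordinal.omega0_opow_add_lt hc ((hw t).trans hwj)
    · rw [row_mul_snd]
      exact (hw t).trans hwj
    · rw [row_mul_fst]
      exact (IsTailInvariant.mul_lt_mul_succ (Nat.lt_succ_self n)).trans_le le_self_add
    · ext
      · rw [col_mul_fst, row_mul_fst, Ordinal.add_sub_cancel]
      · rw [col_mul_snd, row_mul_snd, row_mul_fst, Ordinal.sub_eq_zero_iff_le.2 le_self_add,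
          add_zero]
  obtain ⟨z, -, hz⟩ := (hK.image (hs.continuous_mul_left (col _ hcα))).ultrafilter_le_nhds'
    ((Filter.hyperfilter ℕ).map q) (Ultrafilter.mem_map.2 (Filter.univ_mem' hq))
  have hz' : Filter.Tendsto q (Filter.hyperfilter ℕ) (𝓝 z) := hz
  -- Each `q t` satisfies this equation, which is a closed condition.
  have h1 : diag (k + 1) hk' * z = diag (k + 1) hk' := by
    have hcl : IsClosed ((diag (k + 1) hk' * ·) ⁻¹' {diag (k + 1) hk'}) :=
      isClosed_singleton.preimage (hs.continuous_mul_left _)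
    refine hcl.mem_of_tendsto hz' (Filter.Eventually.of_forall fun t => ?_)
    rw [Set.mem_preimage, Set.mem_singleton_iff]
    ext
    · rw [mul_fst, diag_snd, Ordinal.sub_eq_zero_iff_le.2 (hw t).le, add_zero]
    · rw [mul_snd, diag_snd, Ordinal.add_sub_cancel_of_le (hw t).le]
  -- Otherwise z lies in an open set {a < ω^k t}, which contains no `q s` with s ≥ t. Together with
  -- `h1` this bound determines z.
  have h2 : ω ^ ((k + 1 : ℕ) : Ordinal.{u}) ≤ z.fst := by
    by_contra! h
    obtain ⟨t, ht⟩ := Ordinal.lt_omega0_opow_natCast_succ.1 h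
    obtain ⟨s, hs1, hs2⟩ := (((isOpen_fst_lt hs _).mem_nhds ht |> hz'.eventually_mem).and
      (Filter.Eventually.filter_mono Nat.hyperfilter_le_atTop
        (Filter.eventually_ge_atTop t))).exists
    exact absurd hs1 (not_lt.2 (Ordinal.omega0_opow_mul_natCast_le k hs2))
  have hzd : z = diag (k + 1) hk' := by
    have e1 := congrArg AlphaBicyclic.fst h1
    have e2 := congrArg AlphaBicyclic.snd h1
    rw [mul_fst, diag_fst, diag_snd, Ordinal.add_sub_cancel_of_le h2] at e1
    rw [mul_snd, diag_snd, Ordinal.sub_eq_zero_iff_le.2 h2, add_zero] at e2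
    exact AlphaBicyclic.ext e1 e2
  obtain ⟨t, ht⟩ := (hz'.eventually_mem (hopen.mem_nhds hzd)).exists
  exact (hw t).ne (congrArg AlphaBicyclic.fst ht)

theorem not_isOpen_singleton_diag_of_le (hs : IsShiftContinuous τ) {j l : ℕ} (hj : 1 ≤ j)
    (hjl : j ≤ l) (hl : (l : Ordinal.{u}) < α) (hiso : ¬ IsOpen {diag l hl})
    (hj' : (j : Ordinal.{u}) < α) : ¬ IsOpen {diag j hj'} := by
  induction l, hjl using Nat.le_induction with
  | base => exact hiso
  | succ l hjl ih =>
    have hl' : (l : Ordinal.{u}) < α := lt_trans (by exact_mod_cast Nat.lt_succ_self l) hl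
    obtain ⟨k, rfl⟩ := Nat.exists_eq_succ_of_ne_zero (show l ≠ 0 by omega)
    exact ih hl' (not_isOpen_singleton_diag_of_succ hs hl' hl hiso)

end LocallyCompact

/-- Every locally compact Hausdorff shift-continuous topology on `𝓑_α` is some `τ_{i,α}`. -/
theorem exists_isTau (hα₁ : 1 ≤ α) {τ : TopologicalSpace (AlphaBicyclic α)}
    (hτ : IsLCShiftTopology τ) : ∃ i ∈ Set.Icc 1 α, IsTau α i τ := by
  have := hτ.t2
  have := hτ.locallyCompact
  have hs := hτ.shiftContinuous
  -- The index is the least j ≥ 1 with `diag j` isolated, or α when there is none.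
  by_cases hex : ∃ j : ℕ, 1 ≤ j ∧ ∃ hj : (j : Ordinal.{u}) < α, IsOpen {diag j hj}
  · classical
    obtain ⟨hi, hiα, hopen⟩ := Nat.find_spec hex
    have hmin := fun j => Nat.find_min hex (m := j)
    generalize Nat.find hex = i at hi hiα hopen hmin
    refine ⟨i, ⟨by exact_mod_cast hi, hiα.le⟩, hτ, fun j hj hij => ?_, fun j hj h1 hji => ?_⟩
    · by_contra h
      exact not_isOpen_singleton_diag_of_le hs hi (by exact_mod_cast hij) hj h hiα hopen
    · obtain ⟨k, rfl⟩ := Nat.exists_eq_succ_of_ne_zero (show j ≠ 0 by omega)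
      exact hasBasis_nhds_diag hs hj fun h => hmin _ (by exact_mod_cast hji) ⟨h1, hj, h⟩
  · refine ⟨α, ⟨hα₁, le_rfl⟩, hτ, fun j hj h => absurd hj h.not_gt, fun j hj h1 _ => ?_⟩
    obtain ⟨k, rfl⟩ := Nat.exists_eq_succ_of_ne_zero (show j ≠ 0 by omega)
    exact hasBasis_nhds_diag hs hj fun h => hex ⟨_, h1, hj, h⟩

/-- The involution `(x, y) ↦ (y, x)`. -/
def swap (x : AlphaBicyclic α) : AlphaBicyclic α := ⟨x.snd, x.fst, x.snd_lt, x.fst_lt⟩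

/-! ### Action of the involution and of shifts on translates -/

theorem swap_mul (x y : AlphaBicyclic α) : swap (x * y) = swap y * swap x := by
  ext
  · rw [mul_fst]
    exact mul_snd x y
  · rw [mul_snd]
    exact mul_fst x y

theorem swap_embed (A B : Ordinal.{u}) (hA : A < ω ^ α) (hB : B < ω ^ α) (x : AlphaBicyclic α) :
    swap (embed A B hA hB x) = embed B A hB hA (swap x) := by
  ext
  · rw [embed_fst]
    exact embed_snd A B hA hB x
  · rw [embed_snd]
    exact embed_fst A B hA hB x

theorem swap_mem_basicNhd {j : ℕ} {hj : (j : Ordinal.{u}) < α} {n : ℕ} {x : AlphaBicyclic α}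
    (hx : x ∈ basicNhd j hj n) : swap x ∈ basicNhd j hj n := by
  rcases hx with ⟨h1, h2, h3⟩ | rfl
  · exact .inl ⟨h2, h1, h3.symm⟩
  · exact .inr rfl

theorem embed_zero (h : 0 < ω ^ α) (x : AlphaBicyclic α) : embed 0 0 h h x = x := by
  ext
  · rw [embed_fst, zero_add]
  · rw [embed_snd, zero_add]

theorem row_mul_embed {c A B : Ordinal.{u}} (hc : c < ω ^ α) (hA : A < ω ^ α) (hB : B < ω ^ α)
    (x : AlphaBicyclic α) : row c hc * embed A B hA hB x =
      embed (c + A) B (Ordinal.omega0_opow_add_lt hc hA) hB x := by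
  ext
  · rw [row_mul_fst, embed_fst, embed_fst, add_assoc]
  · rw [row_mul_snd, embed_snd, embed_snd]

/-- The parameter c is first spent on A, and only the rest c - A acts inside the translate. -/
theorem col_mul_embed {c A B : Ordinal.{u}} (hc : c < ω ^ α) (hA : A < ω ^ α) (hB : B < ω ^ α)
    (x : AlphaBicyclic α) : col c hc * embed A B hA hB x =
      embed (A - c) B ((Ordinal.sub_le_self _ _).trans_lt hA) hB
        (col (c - A) ((Ordinal.sub_le_self _ _).trans_lt hc) * x) := by
  ext
  · rw [col_mul_fst, embed_fst, embed_fst, col_mul_fst]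
    rcases le_total c A with h | h
    · obtain ⟨A, rfl⟩ := exists_add_of_le h
      rw [add_assoc, Ordinal.add_sub_cancel, Ordinal.add_sub_cancel,
        Ordinal.sub_eq_zero_iff_le.2 h, Ordinal.sub_zero]
    · obtain ⟨c, rfl⟩ := exists_add_of_le h
      rw [Ordinal.add_sub_add_cancel, Ordinal.add_sub_cancel, Ordinal.sub_eq_zero_iff_le.2 h,
        zero_add]
  · rw [col_mul_snd, embed_fst, embed_snd, embed_snd, col_mul_snd, Ordinal.sub_sub, add_assoc]

/-- A left shift is constant on the translate of `up (diag j)` below its parameter. -/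
theorem col_mul_embed_eq {j : ℕ} {hj : (j : Ordinal.{u}) < α} {c A B : Ordinal.{u}}
    (hc : c < ω ^ α) (hA : A < ω ^ α) (hB : B < ω ^ α) (hAc : A + ω ^ (j : Ordinal.{u}) ≤ c)
    {x : AlphaBicyclic α} (hx : x ∈ up (diag j hj)) :
    col c hc * embed A B hA hB x = col c hc * embed A B hA hB (diag j hj) := by
  obtain ⟨r, rfl⟩ := exists_add_of_le hAc
  obtain ⟨v, h1, h2⟩ := hx
  rw [diag_fst] at h1
  rw [diag_snd] at h2
  ext
  · rw [col_mul_fst, col_mul_fst, embed_fst, embed_fst, diag_fst,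
      Ordinal.sub_eq_zero_iff_le.2 le_self_add, Ordinal.sub_eq_zero_iff_le.2]
    rw [← h1, ← add_assoc, add_assoc]
    exact le_self_add
  · have e : A + ω ^ (j : Ordinal.{u}) + r - (A + x.fst) = v + r := by
      rw [← h1, ← add_assoc, add_assoc, Ordinal.add_sub_cancel]
    rw [col_mul_snd, col_mul_snd, embed_fst, embed_fst, embed_snd, embed_snd, diag_fst, diag_snd,
      e, Ordinal.add_sub_cancel, ← add_assoc, add_assoc B, h2]

theorem exists_col_mul_mem_basicNhd {k : ℕ} (hk : ((k + 1 : ℕ) : Ordinal.{u}) < α)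
    {r : Ordinal.{u}} (hr : r < ω ^ α) (hrk : r < ω ^ ((k + 1 : ℕ) : Ordinal.{u})) (m : ℕ) :
    ∃ n : ℕ, ∀ x ∈ basicNhd (k + 1) hk n, col r hr * x ∈ basicNhd (k + 1) hk m := by
  obtain ⟨l, hl⟩ := Ordinal.lt_omega0_opow_natCast_succ.1 hrk
  -- As r < ω^k l, subtracting r from an ordinal above ω^k (l + m) leaves more than ω^k m.
  refine ⟨l + m, fun x hx => ?_⟩
  rcases mem_basicNhd_iff.1 hx with ⟨h1, h2, h3⟩ | rfl
  · rw [mem_basicNhd_iff, col_mul_fst, col_mul_snd]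
    refine .inl ⟨(Ordinal.sub_le_self _ _).trans_lt h1,
      Ordinal.omega0_opow_add_lt h2 ((Ordinal.sub_le_self _ _).trans_lt hrk), ?_⟩
    refine h3.imp (fun h => ?_) fun h =>
      ((Ordinal.omega0_opow_mul_natCast_le k (by omega)).trans_lt h).trans_le le_self_add
    rw [Ordinal.lt_sub]
    refine lt_of_le_of_lt ?_ h
    rw [Nat.cast_add, mul_add]
    gcongr
  · rw [col_mul_diag hk hr hrk]
    exact .inr rfl

/-- The topology `τ_{i,α}`. -/
@[reducible] def tau (α i : Ordinal.{u}) : TopologicalSpace (AlphaBicyclic α) where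
  IsOpen U := ∀ (k : ℕ) (hk : ((k + 1 : ℕ) : Ordinal.{u}) < α), ((k + 1 : ℕ) : Ordinal.{u}) < i →
    ∀ (A B : Ordinal.{u}) (hA : A < ω ^ α) (hB : B < ω ^ α),
    embed A B hA hB (diag (k + 1) hk) ∈ U →
    ∃ n : ℕ, ∀ x ∈ basicNhd (k + 1) hk n, embed A B hA hB x ∈ U
  isOpen_univ := fun _ _ _ _ _ _ _ _ => ⟨0, fun _ _ => trivial⟩
  isOpen_inter := fun U V hU hV k hk hi A B hA hB h => by
    obtain ⟨m, hm⟩ := hU k hk hi A B hA hB h.1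
    obtain ⟨n, hn⟩ := hV k hk hi A B hA hB h.2
    exact ⟨max m n, fun x hx => ⟨hm x (basicNhd_antitone hk (le_max_left m n) hx),
      hn x (basicNhd_antitone hk (le_max_right m n) hx)⟩⟩
  isOpen_sUnion := fun S hS k hk hi A B hA hB ⟨U, hUS, hU⟩ => by
    obtain ⟨n, hn⟩ := hS U hUS k hk hi A B hA hB hU
    exact ⟨n, fun x hx => ⟨U, hUS, hn x hx⟩⟩

/-! ### Construction of the topologies -/

section tau

variable (i : Ordinal.{u})

theorem isOpen_tau_iff {i : Ordinal.{u}} {U : Set (AlphaBicyclic α)} : IsOpen[tau α i] U ↔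
    ∀ (k : ℕ) (hk : ((k + 1 : ℕ) : Ordinal.{u}) < α), ((k + 1 : ℕ) : Ordinal.{u}) < i →
    ∀ (A B : Ordinal.{u}) (hA : A < ω ^ α) (hB : B < ω ^ α),
    embed A B hA hB (diag (k + 1) hk) ∈ U →
    ∃ n : ℕ, ∀ x ∈ basicNhd (k + 1) hk n, embed A B hA hB x ∈ U :=
  Iff.rfl

theorem continuous_swap_tau : Continuous[tau α i, tau α i] (swap (α := α)) := by
  rw [continuous_def]
  intro U hU k hk hi A B hA hB h
  rw [Set.mem_preimage, swap_embed] at h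
  obtain ⟨n, hn⟩ := hU k hk hi B A hB hA h
  refine ⟨n, fun x hx => ?_⟩
  rw [Set.mem_preimage, swap_embed]
  exact hn _ (swap_mem_basicNhd hx)

theorem continuous_row_mul_tau {c : Ordinal.{u}} (hc : c < ω ^ α) :
    Continuous[tau α i, tau α i] (row c hc * ·) := by
  rw [continuous_def]
  intro U hU k hk hi A B hA hB h
  rw [Set.mem_preimage, row_mul_embed] at h
  obtain ⟨n, hn⟩ := hU k hk hi _ _ _ _ h
  refine ⟨n, fun x hx => ?_⟩
  rw [Set.mem_preimage, row_mul_embed]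
  exact hn x hx

theorem continuous_col_mul_tau {c : Ordinal.{u}} (hc : c < ω ^ α) :
    Continuous[tau α i, tau α i] (col c hc * ·) := by
  rw [continuous_def]
  intro U hU k hk hi A B hA hB h
  rw [Set.mem_preimage] at h
  -- If c reaches past the translate, the shift is constant on it. Otherwise the rest c - A is below
  -- ω^(k+1) and fixes the diagonal point.
  rcases le_or_gt (A + ω ^ ((k + 1 : ℕ) : Ordinal.{u})) c with hAc | hAc
  · refine ⟨0, fun x hx => ?_⟩
    rwa [Set.mem_preimage, col_mul_embed_eq hc hA hB hAc (basicNhd_subset_up hk 0 hx)]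
  · have hr : c - A < ω ^ ((k + 1 : ℕ) : Ordinal.{u}) :=
      Ordinal.sub_lt_of_lt_add hAc (Ordinal.opow_pos _ Ordinal.omega0_pos)
    rw [col_mul_embed, col_mul_diag hk _ hr] at h
    obtain ⟨m, hm⟩ := hU k hk hi _ _ _ _ h
    obtain ⟨n, hn⟩ := exists_col_mul_mem_basicNhd hk (hr.trans (opow_lt_of_lt hk)) hr m
    refine ⟨n, fun x hx => ?_⟩
    rw [Set.mem_preimage, col_mul_embed]
    exact hm _ (hn x hx)

theorem continuous_mul_left_tau (a : AlphaBicyclic α) :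
    Continuous[tau α i, tau α i] (a * ·) := by
  let := tau α i
  have := (continuous_row_mul_tau i a.fst_lt).comp (continuous_col_mul_tau i a.snd_lt)
  convert this using 2 with x
  rw [Function.comp_apply, ← mul_assoc, row_mul_col]

theorem isShiftContinuous_tau : IsShiftContinuous (tau α i) := by
  intro a b
  let := tau α i
  -- Right multiplication by b is left multiplication by `swap b` conjugated by the involution.
  have hb : Continuous fun x : AlphaBicyclic α => x * b := by
    convert (continuous_swap_tau i).comp
      ((continuous_mul_left_tau i (swap b)).comp (continuous_swap_tau i)) using 2 with x
    simp only [Function.comp_apply, swap_mul]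
    rfl
  exact hb.comp (continuous_mul_left_tau i a)

theorem t1Space_tau : @T1Space _ (tau α i) := by
  let := tau α i
  refine ⟨fun q => ⟨fun k hk _ A B hA hB h => ?_⟩⟩
  -- As `embed` is injective, q has at most one preimage x; n is then chosen so that the square of
  -- side ω^k n contains x.
  by_cases hex : ∃ x, x ≠ diag (k + 1) hk ∧ x ∈ up (diag (k + 1) hk) ∧ embed A B hA hB x = q
  · obtain ⟨x, hxp, hx, rfl⟩ := hex
    obtain ⟨h1, h2⟩ := lt_of_mem_up_diag hx hxp
    obtain ⟨m, hm⟩ := Ordinal.lt_omega0_opow_natCast_succ.1 h1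
    obtain ⟨n, hn⟩ := Ordinal.lt_omega0_opow_natCast_succ.1 h2
    refine ⟨max m n, fun y hy hyx => ?_⟩
    obtain rfl : y = x := by
      rw [← retract_embed A B hA hB y, hyx, retract_embed]
    obtain ⟨-, -, h3⟩ := (mem_basicNhd_iff.1 hy).resolve_right hxp
    exact h3.elim
      (hm.trans_le (Ordinal.omega0_opow_mul_natCast_le k (le_max_left m n))).not_gt
      (hn.trans_le (Ordinal.omega0_opow_mul_natCast_le k (le_max_right m n))).not_gt
  · refine ⟨0, fun x hx hxq => hex ⟨x, ?_, basicNhd_subset_up hk 0 hx, hxq⟩⟩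
    rintro rfl
    exact h hxq

theorem isOpen_singleton_one_tau : IsOpen[tau α i] {(1 : AlphaBicyclic α)} := by
  intro k hk _ A B hA hB h
  have := congrArg AlphaBicyclic.fst h
  rw [embed_fst, one_fst, diag_fst, Ordinal.add_eq_zero_iff] at this
  exact absurd this.2 (Ordinal.opow_ne_zero _ Ordinal.omega0_ne_zero)

/-- The clopen sets `up q` separate points, by antisymmetry of the order. -/
theorem t2Space_tau : @T2Space _ (tau α i) := by
  let := tau α i
  have := t1Space_tau (α := α) i
  have hup := isClopen_up (isShiftContinuous_tau (α := α) i) (isOpen_singleton_one_tau i)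
  refine ⟨fun x y hxy => ?_⟩
  by_cases h : x ∈ up y
  · exact ⟨_, _, (hup x).isOpen, (hup x).compl.isOpen, self_mem_up x,
      fun h' => hxy (up_antisymm h h'), disjoint_compl_right⟩
  · exact ⟨_, _, (hup y).compl.isOpen, (hup y).isOpen, h, self_mem_up y, disjoint_compl_left⟩

theorem hasBasis_nhds_diag_tau {i : Ordinal.{u}} {k : ℕ} (hk : ((k + 1 : ℕ) : Ordinal.{u}) < α)
    (hi : ((k + 1 : ℕ) : Ordinal.{u}) < i) :
    (@nhds _ (tau α i) (diag (k + 1) hk)).HasBasis (fun n : ℕ => 1 ≤ n)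
      (basicNhd (k + 1) hk) := by
  let := tau α i
  have := t1Space_tau (α := α) i
  refine ⟨fun V => ⟨fun hV => ?_, ?_⟩⟩
  · obtain ⟨U, hUV, hU, hp⟩ := mem_nhds_iff.1 hV
    have h0 : 0 < ω ^ α := Ordinal.opow_pos _ Ordinal.omega0_pos
    obtain ⟨n, hn⟩ := isOpen_tau_iff.1 hU k hk hi 0 0 h0 h0 (by rwa [embed_zero])
    refine ⟨n + 1, by omega, fun x hx => hUV ?_⟩
    rw [← embed_zero h0 x]
    exact hn x (basicNhd_antitone hk (Nat.le_succ n) hx)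
  · rintro ⟨n, -, hn⟩
    exact Filter.mem_of_superset
      (basicNhd_mem_nhds (isShiftContinuous_tau i) (isOpen_singleton_one_tau i) hk n) hn

theorem isOpen_singleton_diag_tau {i : Ordinal.{u}} {j : ℕ} (hj : (j : Ordinal.{u}) < α)
    (hi : i ≤ j) : IsOpen[tau α i] {diag j hj} := by
  intro k hk hki A B hA hB h
  have := congrArg AlphaBicyclic.fst h
  rw [embed_fst, diag_fst, diag_fst] at this
  have hA' : A < ω ^ (j : Ordinal.{u}) := by
    rw [← this]
    exact lt_add_of_pos_right _ (Ordinal.opow_pos _ Ordinal.omega0_pos)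
  have hkj : k + 1 < j := by exact_mod_cast hki.trans_le hi
  exact absurd this
    (Ordinal.omega0_opow_add_lt hA' (Ordinal.omega0_opow_natCast_lt_iff.2 hkj)).ne

/-- An ultrafilter on `up (diag (k + 1))` either converges to the top point or contains the
complement of some `basicNhd n`. Within `up (diag (k + 1))` that complement is covered by finitely
many translates of `up (diag k)`, compact by induction. -/
theorem isCompact_up_diag_tau {i : Ordinal.{u}} {j : ℕ} (hj : (j : Ordinal.{u}) < α)
    (hi : (j : Ordinal.{u}) < i) : @IsCompact _ (tau α i) (up (diag j hj)) := by
  let := tau α i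
  have := t1Space_tau (α := α) i
  have hs := isShiftContinuous_tau (α := α) i
  induction j with
  | zero =>
    refine (Set.Finite.subset (Set.toFinite {diag 0 hj, 1}) fun x hx => ?_).isCompact
    rw [Set.mem_insert_iff, or_iff_not_imp_left]
    intro hxp
    obtain ⟨h1, h2⟩ := lt_of_mem_up_diag hx hxp
    rw [Nat.cast_zero, Ordinal.opow_zero, Order.lt_one_iff] at h1 h2
    exact AlphaBicyclic.ext h1 h2
  | succ k ih =>
    have hklt : (k : Ordinal.{u}) < ((k + 1 : ℕ) : Ordinal.{u}) := by
      exact_mod_cast Nat.lt_succ_self k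
    have ih := ih (hklt.trans hj) (hklt.trans hi)
    rw [isCompact_iff_ultrafilter_le_nhds']
    intro F hF
    by_cases hall : ∀ n, basicNhd (k + 1) hj n ∈ F
    · exact ⟨_, self_mem_up _, (hasBasis_nhds_diag_tau hj hi).ge_iff.2 fun n _ => hall n⟩
    push Not at hall
    obtain ⟨n, hn⟩ := hall
    have hm : ∀ m : ℕ, ω ^ (k : Ordinal.{u}) * m < ω ^ α := fun m =>
      (Ordinal.omega0_opow_mul_natCast_lt k m).trans (opow_lt_of_lt hj)
    have hR : IsCompact (⋃ (l : Fin (n + 1)) (m : Fin (n + 1)),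
        embed _ _ (hm l) (hm m) '' up (diag k (hklt.trans hj))) :=
      isCompact_iUnion fun l => isCompact_iUnion fun m => ih.image (hs _ _)
    obtain ⟨z, -, hz⟩ := hR.ultrafilter_le_nhds' F (by
      filter_upwards [hF, Ultrafilter.compl_mem_iff_notMem.2 hn] with x hx hxn
      have hxp : x ≠ diag (k + 1) hj := fun h => hxn (.inr h)
      obtain ⟨h1, h2⟩ := lt_of_mem_up_diag hx hxp
      have hle : x.fst ≤ ω ^ (k : Ordinal.{u}) * n ∧ x.snd ≤ ω ^ (k : Ordinal.{u}) * n := by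
        by_contra h
        rw [not_and_or, not_le, not_le] at h
        exact hxn (.inl ⟨h1, h2, h⟩)
      have hW : ω ^ (k : Ordinal.{u}) ≠ 0 := Ordinal.opow_ne_zero _ Ordinal.omega0_ne_zero
      -- Division by ω^k gives a quotient at most n, the index of the translate, and a remainder
      -- below ω^k, a coordinate in `up (diag k)`.
      have hdiv : ∀ y ≤ ω ^ (k : Ordinal.{u}) * n, ∃ l : Fin (n + 1),
          ω ^ (k : Ordinal.{u}) * ((l : ℕ) : Ordinal.{u}) + y % ω ^ (k : Ordinal.{u}) = y := by
        intro y hy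
        have h := Ordinal.div_le_of_le_mul hy
        obtain ⟨l, hl⟩ := Ordinal.lt_omega0.1 (h.trans_lt (Ordinal.natCast_lt_omega0 n))
        rw [hl] at h
        refine ⟨⟨l, Nat.lt_succ_of_le (by exact_mod_cast h)⟩, ?_⟩
        rw [← hl, Ordinal.div_add_mod]
      obtain ⟨l, hl⟩ := hdiv _ hle.1
      obtain ⟨m, hm'⟩ := hdiv _ hle.2
      rw [Set.mem_iUnion₂]
      refine ⟨l, m, ⟨x.fst % ω ^ (k : Ordinal.{u}), x.snd % ω ^ (k : Ordinal.{u}),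
        (Ordinal.mod_le _ _).trans_lt x.fst_lt, (Ordinal.mod_le _ _).trans_lt x.snd_lt⟩,
        mem_up_diag_of_lt (Ordinal.mod_lt _ hW) (Ordinal.mod_lt _ hW), ?_⟩
      ext
      · rw [embed_fst]
        exact hl
      · rw [embed_snd]
        exact hm')
    have hcl := (isClopen_up hs (isOpen_singleton_one_tau i) (diag (k + 1) hj)).isClosed
    exact ⟨z, isClosed_iff_ultrafilter.1 hcl z F hz hF, hz⟩

theorem locallyCompactSpace_tau (hα : α ≤ ω) : @LocallyCompactSpace _ (tau α i) := by
  let := tau α i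
  have := t2Space_tau (α := α) i
  have hs := isShiftContinuous_tau (α := α) i
  have h1 := isOpen_singleton_one_tau (α := α) i
  have : WeaklyLocallyCompactSpace (AlphaBicyclic α) := by
    refine ⟨fun x => ?_⟩
    rcases up_eq_singleton_or_eq_embed hα x with hx | ⟨s, hs', p, q, hA, hB, rfl⟩
    · exact ⟨{x}, isCompact_singleton,
        (isOpen_singleton_of_up_eq hs h1 hx).mem_nhds (Set.mem_singleton x)⟩
    · obtain ⟨K, hK, hKn⟩ : ∃ K, IsCompact K ∧ K ∈ 𝓝 (diag s hs') := by
        rcases lt_or_ge (s : Ordinal.{u}) i with hi | hi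
        · exact ⟨_, isCompact_up_diag_tau hs' hi,
            (isClopen_up hs h1 _).isOpen.mem_nhds (self_mem_up _)⟩
        · exact ⟨_, isCompact_singleton,
            (isOpen_singleton_diag_tau hs' hi).mem_nhds (Set.mem_singleton _)⟩
      refine ⟨_, hK.image (hs (row _ hA) (col _ hB)), ?_⟩
      rw [nhds_embed_diag hs h1 hs' hA hB]
      exact Filter.image_mem_map hKn
  infer_instance

theorem isTau_tau (hα : α ≤ ω) : IsTau α i (tau α i) where
  t2 := t2Space_tau i
  locallyCompact := locallyCompactSpace_tau i hα
  shiftContinuous := isShiftContinuous_tau i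
  isolated _ hj hi := isOpen_singleton_diag_tau hj hi
  hasBasis j hj h1 hi := by
    obtain ⟨k, rfl⟩ := Nat.exists_eq_succ_of_ne_zero (show j ≠ 0 by omega)
    exact hasBasis_nhds_diag_tau hj hi

end tau

end AlphaBicyclic

/-! ### Comparison and uniqueness -/

namespace IsTau

variable {α i j : Ordinal.{u}} {σ τ : TopologicalSpace (AlphaBicyclic α)}

/-- Here `σ ≤ τ` means that σ is finer. At each diagonal point either both filters have the same
base or σ is discrete there. -/
theorem le_of_le (hα : α ≤ ω) (hσ : IsTau α i σ) (hτ : IsTau α j τ) (hij : i ≤ j) : σ ≤ τ := by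
  refine AlphaBicyclic.le_of_nhds_diag_le hα hσ.t2 hσ.shiftContinuous hτ.t2 hτ.shiftContinuous
    fun m hm h1 => ?_
  rcases lt_or_ge (m : Ordinal.{u}) i with h | h
  · exact ((hσ.hasBasis m hm h1 h).eq_of_same_basis (hτ.hasBasis m hm h1 (h.trans_le hij))).le
  · rw [(@isOpen_singleton_iff_nhds_eq_pure _ σ _).1 (hσ.isolated m hm h)]
    exact @pure_le_nhds _ τ _

theorem not_isOpen_singleton_diag (hτ : IsTau α j τ) {m : ℕ} (h1 : 1 ≤ m)
    (hm : (m : Ordinal.{u}) < α) (hmj : (m : Ordinal.{u}) < j) :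
    ¬ IsOpen[τ] {AlphaBicyclic.diag m hm} := by
  intro h
  obtain ⟨k, rfl⟩ := Nat.exists_eq_succ_of_ne_zero (show m ≠ 0 by omega)
  obtain ⟨n, -, hn⟩ := (hτ.hasBasis _ hm h1 hmj).mem_iff.1 (h.mem_nhds (Set.mem_singleton _))
  -- The point (ω^k (n + 1), 0) belongs to `basicNhd n` and differs from the diagonal point.
  have hlt := Ordinal.omega0_opow_mul_natCast_lt.{u} k (n + 1)
  have := hn (show AlphaBicyclic.row _ (hlt.trans (AlphaBicyclic.opow_lt_of_lt hm)) ∈ _ from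
    .inl ⟨hlt, Ordinal.opow_pos _ Ordinal.omega0_pos,
      .inl (IsTailInvariant.mul_lt_mul_succ (Nat.lt_succ_self n))⟩)
  exact hlt.ne (congrArg AlphaBicyclic.fst this)

theorem openSets_ssubset (hα : α ≤ ω) (hi : 1 ≤ i) (hj : j ≤ α) (hij : i < j)
    (hσ : IsTau α i σ) (hτ : IsTau α j τ) : openSets τ ⊂ openSets σ := by
  refine ⟨hσ.le_of_le hα hτ hij.le, fun h => ?_⟩
  -- Since i < j ≤ α ≤ ω, the index i is a natural number m with m < α, and `diag m` is isolated for
  -- σ but not for τ.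
  obtain ⟨m, rfl⟩ := Ordinal.lt_omega0.1 (hij.trans_le (hj.trans hα))
  have hm := hij.trans_le hj
  exact hτ.not_isOpen_singleton_diag (by exact_mod_cast hi) hm hij (h (hσ.isolated m hm le_rfl))

theorem unique (hα : α ≤ ω) (hσ : IsTau α i σ) (hτ : IsTau α i τ) : σ = τ :=
  le_antisymm (hσ.le_of_le hα hτ le_rfl) (hτ.le_of_le hα hσ le_rfl)

theorem index_unique (hα : α ≤ ω) (hi : i ∈ Set.Icc 1 α) (hj : j ∈ Set.Icc 1 α)
    (h : IsTau α i τ) (h' : IsTau α j τ) : i = j := by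
  rcases lt_trichotomy i j with hij | hij | hij
  · exact absurd (h.openSets_ssubset hα hi.1 hj.2 hij h') (ssubset_irrefl _)
  · exact hij
  · exact absurd (h'.openSets_ssubset hα hj.1 hi.2 hij h) (ssubset_irrefl _)

end IsTau

theorem mainTheorem2 (α : Ordinal.{u}) (hα₁ : 1 ≤ α) (hα : α ≤ ω) :
    -- for `1 ≤ i ≤ α` the topology `τ_{i,α}` exists and is unique
    (∀ i ∈ Set.Icc 1 α, ∃! τ : TopologicalSpace (AlphaBicyclic α), IsTau α i τ) ∧
    -- these are exactly the locally compact Hausdorff shift-continuous topologies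
    {τ : TopologicalSpace (AlphaBicyclic α) | IsLCShiftTopology τ} =
      {τ | ∃ i ∈ Set.Icc 1 α, IsTau α i τ} ∧
    -- `τ_{j,α}` is strictly contained in `τ_{i,α}` for `i < j`
    (∀ i ∈ Set.Icc 1 α, ∀ j ∈ Set.Icc 1 α, i < j →
      ∀ σ τ : TopologicalSpace (AlphaBicyclic α), IsTau α i σ → IsTau α j τ →
        openSets τ ⊂ openSets σ) ∧
    -- anti-isomorphism, given by `τ_{i,α} ↦ i`, with the segment `[1, α]`
    (∃ f : {τ : TopologicalSpace (AlphaBicyclic α) // IsLCShiftTopology τ} ≃ Set.Icc 1 α,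
      (∀ τ, IsTau α (f τ : Ordinal.{u}) τ.1) ∧
      ∀ σ τ, openSets σ.1 ⊆ openSets τ.1 ↔ f τ ≤ f σ) := by
  have hstrict : ∀ i ∈ Set.Icc 1 α, ∀ j ∈ Set.Icc 1 α, i < j →
      ∀ σ τ : TopologicalSpace (AlphaBicyclic α), IsTau α i σ → IsTau α j τ →
        openSets τ ⊂ openSets σ :=
    fun i hi j hj hij σ τ hσ hτ => hσ.openSets_ssubset hα hi.1 hj.2 hij hτ
  refine ⟨fun i _ => ⟨_, AlphaBicyclic.isTau_tau i hα, fun σ hσ =>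
    hσ.unique hα (AlphaBicyclic.isTau_tau i hα)⟩, ?_, hstrict, ?_⟩
  · ext τ
    exact ⟨AlphaBicyclic.exists_isTau hα₁, fun ⟨i, _, h⟩ => h.toIsLCShiftTopology⟩
  · choose g hg hgτ using fun τ : {τ : TopologicalSpace (AlphaBicyclic α) //
      IsLCShiftTopology τ} => AlphaBicyclic.exists_isTau hα₁ τ.2
    have hbij : Function.Bijective fun τ => (⟨g τ, hg τ⟩ : Set.Icc 1 α) := by
      refine ⟨fun σ τ h => Subtype.ext ?_, fun i => ?_⟩
      · have h' : g σ = g τ := congrArg Subtype.val h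
        exact (hgτ σ).unique hα (h' ▸ hgτ τ)
      · have hi := AlphaBicyclic.isTau_tau i.1 hα
        exact ⟨⟨_, hi.toIsLCShiftTopology⟩,
          Subtype.ext ((hgτ ⟨_, hi.toIsLCShiftTopology⟩).index_unique hα (hg _) i.2 hi)⟩
    refine ⟨Equiv.ofBijective _ hbij, hgτ, fun σ τ => ⟨fun h => ?_, fun h => ?_⟩⟩
    · by_contra! hlt
      exact (hstrict _ (hg σ) _ (hg τ) hlt _ _ (hgτ σ) (hgτ τ)).2 h
    · exact (hgτ τ).le_of_le hα (hgτ σ) h
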